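/- Let $k$ be a field of characteristic $\neq 2$. Let $Q \subset \mathbb{P}^3_k$ be a quadric surface cone whose base is a smooth conic $Q_0$; that is, $Q$ is the zero locus of a quadratic form $q$ on $k^4$, there are a $k$-point $p \in \mathbb{P}^3(k)$ (the vertex) and a plane $\mathbb{P}(W) \subset \mathbb{P}^3_k$ not containing $p$, such that $q$ is the pullback of $q_0 = q|_W$ along the projection of $k^4$ onto $W$ with kernel the line $p$, and $Q_0 = \{q_0 = 0\} \subset \mathbb{P}(W)$ is smooth. Let $k(Q)$ be the function field of $Q$, and let $c(Q_0) \in \mathrm{Br}(k)$ be the Clifford invariant of $Q_0$, i.e. the Brauer class of the even Clifford algebra $C_0(q_0)$. Then $$\ker\bigl(\mathrm{Br}(k) \to \mathrm{Br}(k(Q))\bigr) = \mathbb{Z}/2\mathbb{Z}\cdot c(Q_0),$$ that is, the kernel of the restriction homomorphism $\mathrm{Br}(k) \to \mathrm{Br}(k(Q))$, $[A] \mapsto [A \otimes_k k(Q)]$, is the subgroup of $\mathrm{Br}(k)$ generated by $c(Q_0)$, and $2\,c(Q_0) = 0$. -/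

import Mathlib

open scoped TensorProduct Quaternion

universe u

namespace BrauerGroup

section Tensor

variable (k : Type*) {A B : Type*} [Field k] [Ring A] [Algebra k A] [Ring B] [Algebra k B]

theorem exists_coords (A B : Type*) [Ring A] [Algebra k A] [Ring B] [Algebra k B] :
    ∃ (c : Module.Basis.ofVectorSpaceIndex k B → B)
      (E : A ⊗[k] B ≃ₗ[k] Module.Basis.ofVectorSpaceIndex k B →₀ A),
      (∀ (a : A) (x : A ⊗[k] B) i, E ((a ⊗ₜ 1) * x) i = a * E x i) ∧
      (∀ (a : A) (x : A ⊗[k] B) i, E (x * (a ⊗ₜ 1)) i = E x i * a) ∧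
      (∀ x : A ⊗[k] B, x = (E x).sum fun i m => m ⊗ₜ[k] c i) := by
  classical
  refine ⟨Module.Basis.ofVectorSpace k B,
    TensorProduct.equivFinsuppOfBasisRight (M := A) (Module.Basis.ofVectorSpace k B),
    fun a x i => ?_, fun a x i => ?_, fun x => ?_⟩
  · induction x with
    | zero => simp
    | add x y hx hy => simp [mul_add, hx, hy]
    | tmul p q => simp
  · induction x with
    | zero => simp
    | add x y hx hy => simp [add_mul, hx, hy]
    | tmul p q => simp
  · rw [← TensorProduct.equivFinsuppOfBasisRight_symm_apply, LinearEquiv.symm_apply_apply]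

theorem exists_eq_one_tmul [Algebra.IsCentral k A] (y : A ⊗[k] B)
    (hy : ∀ a : A, (a ⊗ₜ[k] (1 : B)) * y = y * (a ⊗ₜ[k] (1 : B))) :
    ∃ b : B, y = (1 : A) ⊗ₜ[k] b := by
  obtain ⟨c, E, hl, hr, hs⟩ := exists_coords k A B
  have hz (i) : ∃ r : k, E y i = algebraMap k A r := by
    refine (Algebra.IsCentral.mem_center_iff k).mp (Subalgebra.mem_center_iff.mpr fun a => ?_)
    rw [← hl, ← hr, hy]
  choose r hr' using hz
  refine ⟨(E y).sum fun i _ => r i • c i, ?_⟩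
  rw [Finsupp.sum, TensorProduct.tmul_sum]
  refine (hs y).trans (Finset.sum_congr rfl fun i _ => ?_)
  simp only [hr', Algebra.algebraMap_eq_smul_one, TensorProduct.smul_tmul]

theorem isSimpleRing_tensorProduct (A B : Type*) [Ring A] [Algebra k A] [Ring B]
    [Algebra k B] [Algebra.IsCentral k A] [IsSimpleRing A] [IsSimpleRing B] :
    IsSimpleRing (A ⊗[k] B) := by
  classical
  obtain ⟨c, E, hl, hr, hs⟩ := exists_coords k A B
  refine IsSimpleRing.of_eq_bot_or_eq_top fun I => ?_
  rw [or_iff_not_imp_left, ← I.one_mem_iff]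
  intro H
  obtain ⟨x₀, hx₀1, hx₀2 : x₀ ≠ 0⟩ := SetLike.exists_of_lt (bot_lt_iff_ne_bot.mpr H : ⊥ < I)
  obtain ⟨x, ⟨hxI, hx0⟩, hmin⟩ := exists_minimalFor_of_wellFoundedLT
    (fun x : A ⊗[k] B => x ∈ I ∧ x ≠ 0) (fun x => (E x).support.card) ⟨x₀, hx₀1, hx₀2⟩
  have hEx : E x ≠ 0 := by simpa using hx0
  obtain ⟨j, hj⟩ := Finsupp.ne_iff.mp hEx
  let J : TwoSidedIdeal A := TwoSidedIdeal.mk'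
    {c | ∃ y ∈ I, (E y).support ⊆ (E x).support ∧ E y j = c}
    ⟨0, I.zero_mem, by simp, by simp⟩
    (by
      rintro _ _ ⟨y, hy, hys, rfl⟩ ⟨z, hz, hzs, rfl⟩
      refine ⟨y + z, I.add_mem hy hz, ?_, by simp⟩
      rw [map_add]
      exact Finsupp.support_add.trans (Finset.union_subset hys hzs))
    (by
      rintro _ ⟨y, hy, hys, rfl⟩
      exact ⟨-y, I.neg_mem hy, by simpa using hys, by simp⟩)
    (by
      rintro a _ ⟨y, hy, hys, rfl⟩
      refine ⟨(a ⊗ₜ 1) * y, I.mul_mem_left _ _ hy, fun i hi => hys ?_, hl _ _ _⟩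
      rw [Finsupp.mem_support_iff, hl] at hi
      exact Finsupp.mem_support_iff.mpr (right_ne_zero_of_mul hi))
    (by
      rintro _ a ⟨y, hy, hys, rfl⟩
      refine ⟨y * (a ⊗ₜ 1), I.mul_mem_right _ _ hy, fun i hi => hys ?_, hr _ _ _⟩
      rw [Finsupp.mem_support_iff, hr] at hi
      exact Finsupp.mem_support_iff.mpr (left_ne_zero_of_mul hi))
  have h1 : (1 : A) ∈ J := IsSimpleRing.one_mem_of_ne_zero_mem J (x := E x j) (by simpa using hj)
    ((TwoSidedIdeal.mem_mk' ..).mpr ⟨x, hxI, subset_rfl, rfl⟩)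
  obtain ⟨y, hyI, hys, hyj⟩ := (TwoSidedIdeal.mem_mk' ..).mp h1
  have hjs : j ∈ (E x).support := Finsupp.mem_support_iff.mpr (by simpa using hj)
  have hc (a : A) : (a ⊗ₜ 1) * y - y * (a ⊗ₜ 1) = 0 := by
    by_contra hne
    have hsub : (E ((a ⊗ₜ 1) * y - y * (a ⊗ₜ 1))).support ⊆ (E x).support.erase j := by
      intro i hi
      rw [Finsupp.mem_support_iff, map_sub, Finsupp.sub_apply, hl, hr] at hi
      refine Finset.mem_erase.mpr ⟨?_, hys (Finsupp.mem_support_iff.mpr ?_)⟩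
      · rintro rfl; simp [hyj] at hi
      · intro h0; simp [h0] at hi
    have hlt := (Finset.card_le_card hsub).trans_lt (Finset.card_erase_lt_of_mem hjs)
    exact absurd (hmin ⟨I.sub_mem (I.mul_mem_left _ _ hyI) (I.mul_mem_right _ _ hyI), hne⟩
      hlt.le) (not_le.mpr hlt)
  obtain ⟨b, rfl⟩ := exists_eq_one_tmul k y fun a => sub_eq_zero.mp (hc a)
  have hb : b ≠ 0 := by
    rintro rfl
    simp at hyj
  let L : TwoSidedIdeal B := I.comap (Algebra.TensorProduct.includeRight : B →ₐ[k] A ⊗[k] B)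
  have : (1 : B) ∈ L := IsSimpleRing.one_mem_of_ne_zero_mem L hb
    ((TwoSidedIdeal.mem_comap _).mpr hyI)
  exact (TwoSidedIdeal.mem_comap _).mp this

theorem isCentral_tensorProduct (A B : Type*) [Ring A] [Algebra k A] [Ring B]
    [Algebra k B] [Algebra.IsCentral k A] [Nontrivial A] [Algebra.IsCentral k B] :
    Algebra.IsCentral k (A ⊗[k] B) where
  out z hz := by
    rw [Subalgebra.mem_center_iff] at hz
    obtain ⟨b, rfl⟩ := exists_eq_one_tmul k z fun a => hz _
    obtain ⟨r, rfl⟩ := (Algebra.IsCentral.mem_center_iff k).mp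
      (Subalgebra.mem_center_iff.mpr fun b' =>
        Algebra.TensorProduct.includeRight_injective (R := k) (A := A) (B := B)
          (FaithfulSMul.algebraMap_injective k A) (by simpa using hz (1 ⊗ₜ b')))
    exact Algebra.mem_bot.mpr ⟨r, (Algebra.TensorProduct.includeRight :
      B →ₐ[k] A ⊗[k] B).commutes r |>.symm⟩

theorem isSimpleRing_baseChange (K A : Type*) [Field K] [Algebra k K] [Ring A]
    [Algebra k A] [Algebra.IsCentral k A] [IsSimpleRing A] :
    IsSimpleRing (K ⊗[k] A) :=
  have := isSimpleRing_tensorProduct k A K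
  .of_surjective (Algebra.TensorProduct.comm k A K).toRingEquiv.toRingHom this
    (Algebra.TensorProduct.comm k A K).surjective

theorem isCentral_baseChange (K A : Type*) [Field K] [Algebra k K] [Ring A]
    [Algebra k A] [Algebra.IsCentral k A] :
    Algebra.IsCentral K (K ⊗[k] A) where
  out z hz := by
    rw [Subalgebra.mem_center_iff] at hz
    obtain ⟨r, hr⟩ := exists_eq_one_tmul k (Algebra.TensorProduct.comm k K A z) fun a => by
      simpa using congr(Algebra.TensorProduct.comm k K A $(hz (1 ⊗ₜ a)))
    refine Algebra.mem_bot.mpr ⟨r, (Algebra.TensorProduct.comm k K A).injective ?_⟩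
    rw [hr]
    simp

end Tensor

section Group

variable {k : Type u} [Field k]

/-- The central simple algebra with underlying algebra `A`. -/
abbrev mkCSA (A : Type u) [Ring A] [Algebra k A] (h₁ : Algebra.IsCentral k A)
    (h₂ : IsSimpleRing A) (h₃ : FiniteDimensional k A) : CSA.{u, u} k where
  toAlgCat := .of k A
  isCentral := h₁
  isSimple := h₂
  fin_dim := h₃

theorem equivalent_of_algEquiv {A B : CSA.{u, u} k} (e : A ≃ₐ[k] B) : IsBrauerEquivalent A B :=
  ⟨1, 1, one_ne_zero, one_ne_zero, ⟨e.mapMatrix⟩⟩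

/-- The tensor product of central simple algebras. -/
noncomputable abbrev tensor (A B : CSA.{u, u} k) : CSA.{u, u} k :=
  mkCSA (A ⊗[k] B) (isCentral_tensorProduct k A B) (isSimpleRing_tensorProduct k A B) inferInstance

/-- The base field as a central simple algebra over itself. -/
abbrev unitCSA (k : Type u) [Field k] : CSA.{u, u} k :=
  mkCSA k inferInstance inferInstance inferInstance

/-- The opposite of a central simple algebra. -/
abbrev opposite (A : CSA.{u, u} k) : CSA.{u, u} k :=
  mkCSA Aᵐᵒᵖ inferInstance inferInstance inferInstance

theorem tensor_congr {A A' B B' : CSA.{u, u} k} (hA : IsBrauerEquivalent A A')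
    (hB : IsBrauerEquivalent B B') : IsBrauerEquivalent (tensor A B) (tensor A' B') := by
  obtain ⟨n, m, hn, hm, ⟨e⟩⟩ := hA
  obtain ⟨p, q, hp, hq, ⟨f⟩⟩ := hB
  refine ⟨n * p, m * q, mul_ne_zero hn hp, mul_ne_zero hm hq, ⟨?_⟩⟩
  exact (Matrix.reindexAlgEquiv k (A ⊗[k] B) finProdFinEquiv).symm.trans
    ((Matrix.kroneckerTMulAlgEquiv (Fin n) (Fin p) k k A B).symm.trans
    ((Algebra.TensorProduct.congr e f).trans
    ((Matrix.kroneckerTMulAlgEquiv (Fin m) (Fin q) k k A' B').trans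
    (Matrix.reindexAlgEquiv k (A' ⊗[k] B') finProdFinEquiv))))

theorem opposite_congr {A B : CSA.{u, u} k} (h : IsBrauerEquivalent A B) :
    IsBrauerEquivalent (opposite A) (opposite B) := by
  obtain ⟨n, m, hn, hm, ⟨e⟩⟩ := h
  exact ⟨n, m, hn, hm, ⟨AlgEquiv.mopMatrix.trans (e.op.trans AlgEquiv.mopMatrix.symm)⟩⟩

theorem tensor_opposite (A : CSA.{u, u} k) :
    IsBrauerEquivalent (tensor A (opposite A)) (unitCSA k) := by
  have hs : IsSimpleRing (A ⊗[k] Aᵐᵒᵖ) := (tensor A (opposite A)).isSimple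
  have hinj : Function.Injective (AlgHom.mulLeftRight k A) :=
    (AlgHom.mulLeftRight k A).toRingHom.injective
  have hbij : Function.Bijective (AlgHom.mulLeftRight k A) := by
    refine ⟨hinj, (LinearMap.injective_iff_surjective_of_finrank_eq_finrank
      (f := (AlgHom.mulLeftRight k A).toLinearMap) ?_).mp hinj⟩
    rw [Module.finrank_tensorProduct, Module.finrank_linearMap,
      (MulOpposite.opLinearEquiv k (M := A)).finrank_eq]
  refine ⟨1, Module.finrank k A, one_ne_zero, Module.finrank_pos.ne', ⟨?_⟩⟩
  exact ((AlgEquiv.ofBijective _ hbij).trans (algEquivMatrix (Module.finBasis k A))).mapMatrix.trans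
    ((Matrix.compAlgEquiv _ _ _ _).trans
      (Matrix.reindexAlgEquiv k k (Equiv.uniqueProd (Fin _) (Fin 1))))

/-- The group structure on the Brauer group, induced by the tensor product. -/
noncomputable instance : CommGroup (BrauerGroup.{u, u} k) where
  mul := Quotient.map₂ tensor fun _ _ hA _ _ hB => tensor_congr hA hB
  one := Quotient.mk _ (unitCSA k)
  inv := Quotient.map opposite fun _ _ h => opposite_congr h
  mul_assoc := by
    rintro ⟨A⟩ ⟨B⟩ ⟨C⟩
    exact Quotient.sound (equivalent_of_algEquiv (Algebra.TensorProduct.assoc k k k A B C))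
  one_mul := by
    rintro ⟨A⟩
    exact Quotient.sound (equivalent_of_algEquiv (Algebra.TensorProduct.lid k A))
  mul_one := by
    rintro ⟨A⟩
    exact Quotient.sound (equivalent_of_algEquiv (Algebra.TensorProduct.rid k k A))
  mul_comm := by
    rintro ⟨A⟩ ⟨B⟩
    exact Quotient.sound (equivalent_of_algEquiv (Algebra.TensorProduct.comm k A B))
  inv_mul_cancel := by
    rintro ⟨A⟩
    exact Quotient.sound ((equivalent_of_algEquiv (Algebra.TensorProduct.comm k Aᵐᵒᵖ A)).trans
      (tensor_opposite A))

variable (K : Type u) [Field K] [Algebra k K]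

/-- Extension of scalars of a central simple algebra. -/
noncomputable abbrev extend (A : CSA.{u, u} k) : CSA.{u, u} K :=
  mkCSA (K ⊗[k] A) (isCentral_baseChange k K A) (isSimpleRing_baseChange k K A) inferInstance

theorem extend_congr {A B : CSA.{u, u} k} (h : IsBrauerEquivalent A B) :
    IsBrauerEquivalent (extend K A) (extend K B) := by
  obtain ⟨n, m, hn, hm, ⟨e⟩⟩ := h
  have key (A : CSA.{u, u} k) (n : ℕ) :
      Nonempty (K ⊗[k] Matrix (Fin n) (Fin n) A ≃ₐ[K] Matrix (Fin n) (Fin n) (K ⊗[k] A)) :=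
    ⟨(Algebra.TensorProduct.congr (Matrix.uniqueAlgEquiv (m := Unit) (R := K) (A := K)).symm
      (AlgEquiv.refl (R := k))).trans
      ((Matrix.kroneckerTMulAlgEquiv Unit (Fin n) k K K A).trans
      (Matrix.reindexAlgEquiv K (K ⊗[k] A) (Equiv.punitProd (Fin n))))⟩
  obtain ⟨f⟩ := key A n
  obtain ⟨g⟩ := key B m
  exact ⟨n, m, hn, hm,
    ⟨f.symm.trans ((Algebra.TensorProduct.congr (AlgEquiv.refl (R := K)) e).trans g)⟩⟩

variable (k)

/-- The restriction homomorphism `Br(k) → Br(K)`, sending the class of `A` to that of `K ⊗ A`. -/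
noncomputable def restrict : BrauerGroup.{u, u} k →* BrauerGroup.{u, u} K where
  toFun := Quotient.map (extend K) fun _ _ h => extend_congr K h
  map_one' := Quotient.sound (equivalent_of_algEquiv (Algebra.TensorProduct.rid k K K))
  map_mul' := by
    rintro ⟨A⟩ ⟨B⟩
    exact Quotient.sound (equivalent_of_algEquiv
      ((Algebra.TensorProduct.tensorTensorTensorComm k k K K K A K B).trans
        (Algebra.TensorProduct.congr (Algebra.TensorProduct.lid K K) AlgEquiv.refl)).symm)

end Group
end BrauerGroup

namespace QuaternionAlgebra

variable {k : Type*} [Field k] {a b : k}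

theorem one_mem_of_re_ne_zero (h2 : (2 : k) ≠ 0) (ha : a ≠ 0) (hb : b ≠ 0)
    (I : TwoSidedIdeal ℍ[k,a,0,b]) {x : ℍ[k,a,0,b]} (hx : x ∈ I) (hre : x.re ≠ 0) : 1 ∈ I := by
  let i : ℍ[k,a,0,b] := ⟨0, 1, 0, 0⟩
  let j : ℍ[k,a,0,b] := ⟨0, 0, 1, 0⟩
  let y := algebraMap k _ a * x + i * x * i
  have hy : y ∈ I := I.add_mem (I.mul_mem_left _ _ hx) (I.mul_mem_right _ _ (I.mul_mem_left _ _ hx))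
  have hz : algebraMap k _ (4 * a * b * x.re)⁻¹ * (algebraMap k _ b * y + j * y * j) ∈ I :=
    I.mul_mem_left _ _
      (I.add_mem (I.mul_mem_left _ _ hy) (I.mul_mem_right _ _ (I.mul_mem_left _ _ hy)))
  convert hz using 1
  have h4 : (4 : k) ≠ 0 := by
    have : (4 : k) = 2 * 2 := by norm_num
    rw [this]; exact mul_ne_zero h2 h2
  ext
  · simp [i, j, y]
    field_simp
    ring
  all_goals
    simp [i, j, y]
    try exact Or.inr (by ring)

theorem isSimpleRing (h2 : (2 : k) ≠ 0) (ha : a ≠ 0) (hb : b ≠ 0) :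
    IsSimpleRing ℍ[k,a,0,b] := by
  refine IsSimpleRing.of_eq_bot_or_eq_top fun I => ?_
  rw [or_iff_not_imp_left, ← I.one_mem_iff]
  intro H
  obtain ⟨x, hx, hx0 : x ≠ 0⟩ := SetLike.exists_of_lt (bot_lt_iff_ne_bot.mpr H : ⊥ < I)
  by_contra h1
  have key (y : ℍ[k,a,0,b]) : (y * x).re = 0 := by
    by_contra hne
    exact h1 (one_mem_of_re_ne_zero h2 ha hb I (I.mul_mem_left y x hx) hne)
  have e0 := key 1
  have e1 := key ⟨0, 1, 0, 0⟩
  have e2 := key ⟨0, 0, 1, 0⟩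
  have e3 := key ⟨0, 0, 0, 1⟩
  simp [ha, hb] at e0 e1 e2 e3
  exact hx0 (by ext <;> simp [*])

theorem isCentral (h2 : (2 : k) ≠ 0) (ha : a ≠ 0) :
    Algebra.IsCentral k ℍ[k,a,0,b] where
  out z hz := by
    rw [Subalgebra.mem_center_iff] at hz
    have hi := hz ⟨0, 1, 0, 0⟩
    have hj := hz ⟨0, 0, 1, 0⟩
    have e1 := congr(($hi).imJ)
    have e2 := congr(($hi).imK)
    have e3 := congr(($hj).imK)
    simp at e1 e2 e3
    have z3 : z.imK = 0 := by
      have : 2 * a * z.imK = 0 := by linear_combination e1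
      simpa [h2, ha] using this
    have z2 : z.imJ = 0 := by
      have : 2 * z.imJ = 0 := by linear_combination e2
      simpa [h2] using this
    have z1 : z.imI = 0 := by
      have : 2 * z.imI = 0 := by linear_combination -e3
      simpa [h2] using this
    exact Algebra.mem_bot.mpr ⟨z.re, by ext <;> simp [z1, z2, z3]⟩

end QuaternionAlgebra

namespace Quadric

section Clifford
open CliffordAlgebra

variable {k V W : Type*} [Field k] [AddCommGroup V] [Module k V] [AddCommGroup W] [Module k W]

/-- The map of even Clifford algebras induced by a similarity. -/
noncomputable def evenMapOfSimilarity (q : QuadraticForm k V) (r : QuadraticForm k W)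
    (f : V →ₗ[k] W) (u : kˣ)
    (h : ∀ v, r (f v) = u * q v) : even q →ₐ[k] even r :=
  even.lift q
    { bilin := (u⁻¹ : kˣ).1 • (even.ι r).bilin.compl₁₂ f f
      contract := fun m => by
        simp [(even.ι r).contract, h, Algebra.smul_def, ← map_mul]
      contract_mid := fun m₁ m₂ m₃ => by
        simp only [LinearMap.smul_apply, LinearMap.compl₁₂_apply, smul_mul_smul_comm,
          (even.ι r).contract_mid, h, smul_smul]
        congr 1
        have := u.ne_zero
        simp only [Units.val_inv_eq_inv_val]
        field_simp }

theorem evenMapOfSimilarity_ι (q : QuadraticForm k V) (r : QuadraticForm k W)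
    (f : V →ₗ[k] W) (u : kˣ)
    (h : ∀ v, r (f v) = u * q v) (x y : V) :
    evenMapOfSimilarity q r f u h ((even.ι q).bilin x y) =
      (u⁻¹ : kˣ).1 • (even.ι r).bilin (f x) (f y) := by
  rw [evenMapOfSimilarity, even.lift_ι]
  rfl

/-- Similar forms have isomorphic even Clifford algebras. -/
noncomputable def evenEquivOfSimilarity (q : QuadraticForm k V) (r : QuadraticForm k W)
    (f : V ≃ₗ[k] W) (u : kˣ)
    (h : ∀ v, r (f v) = u * q v) : even q ≃ₐ[k] even r :=
  AlgEquiv.ofAlgHom (evenMapOfSimilarity q r f u h)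
    (evenMapOfSimilarity r q f.symm u⁻¹ fun w => by
      have := h (f.symm w)
      simp only [LinearEquiv.apply_symm_apply] at this
      simp [this])
    (by
      ext x y : 4
      simp [evenMapOfSimilarity_ι])
    (by
      ext x y : 4
      simp [evenMapOfSimilarity_ι])

theorem exists_even_equiv_quaternion [Invertible (2 : k)] [FiniteDimensional k V]
    (q : QuadraticForm k V) (h3 : Module.finrank k V = 3)
    (hq : (QuadraticMap.associated (R := k) q).SeparatingLeft) :
    ∃ a b : k, a ≠ 0 ∧ b ≠ 0 ∧ Nonempty (even q ≃ₐ[k] ℍ[k,a,0,b]) := by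
  obtain ⟨w, ⟨e⟩⟩ : ∃ w : Fin 3 → kˣ, q.Equivalent (QuadraticMap.weightedSumSquares k w) := by
    rw [← h3]
    exact q.equivalent_weightedSumSquares_units_of_nondegenerate' hq
  let a : k := -(w 0 / w 2)
  let b : k := -(w 1 / w 2)
  let u : kˣ := -(w 2)⁻¹
  let g : (Fin 3 → k) ≃ₗ[k] (k × k) × k :=
    { toFun := fun v => ((v 0, v 1), v 2)
      invFun := fun p => ![p.1.1, p.1.2, p.2]
      map_add' := fun _ _ => rfl
      map_smul' := fun _ _ => rfl
      left_inv := fun v => by ext i; fin_cases i <;> rfl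
      right_inv := fun _ => rfl }
  refine ⟨a, b, by simp [a], by simp [b], ⟨?_⟩⟩
  refine (evenEquivOfSimilarity q (EquivEven.Q' (CliffordAlgebraQuaternion.Q a b))
    (e.toLinearEquiv.trans g) u fun v => ?_).trans
      ((equivEven (CliffordAlgebraQuaternion.Q a b)).symm.trans CliffordAlgebraQuaternion.equiv)
  have h := e.map_app v
  rw [← h, QuadraticMap.weightedSumSquares_apply, Fin.sum_univ_three]
  have hg (v : Fin 3 → k) : g v = ((v 0, v 1), v 2) := rfl
  simp [hg, a, b, u, Units.smul_def]
  field_simp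
  ring

theorem even_isCSA {k V : Type u} [Field k] [AddCommGroup V] [Module k V]
    [Invertible (2 : k)] [FiniteDimensional k V] (q : QuadraticForm k V) (h3 : Module.finrank k V = 3)
    (hq : (QuadraticMap.associated (R := k) q).SeparatingLeft) :
    Algebra.IsCentral k (even q) ∧ IsSimpleRing (even q) ∧ FiniteDimensional k (even q) := by
  obtain ⟨a, b, ha, hb, ⟨e⟩⟩ := exists_even_equiv_quaternion q h3 hq
  have h2 : (2 : k) ≠ 0 := Invertible.ne_zero 2
  have := QuaternionAlgebra.isCentral (b := b) h2 ha
  have hs := QuaternionAlgebra.isSimpleRing h2 ha hb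
  exact ⟨.of_algEquiv k _ _ e.symm,
    .of_surjective e.symm.toRingEquiv.toRingHom hs e.symm.surjective,
    Module.Finite.equiv e.symm.toLinearEquiv⟩

end Clifford

section Smooth

variable {k : Type*} [Field k] [Invertible (2 : k)] {V : Type*} [AddCommGroup V] [Module k V]

/-- The quadric `{q = 0}` in `ℙ(V)` is smooth: by the Jacobian criterion, at no geometric point
of the quadric does the differential `w ↦ polar q v w` of `q` vanish. -/
def IsSmooth (q : QuadraticForm k V) : Prop :=
  ∀ v : AlgebraicClosure k ⊗[k] V, v ≠ 0 → q.baseChange (AlgebraicClosure k) v = 0 →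
    ∃ w, QuadraticMap.polar (q.baseChange (AlgebraicClosure k)) v w ≠ 0

theorem IsSmooth.eq_zero {q : QuadraticForm k V} (hq : IsSmooth q) {v : V}
    (hv : ∀ w, QuadraticMap.polar q v w = 0) : v = 0 := by
  by_contra hne
  have hinj := Module.FaithfullyFlat.tensorProduct_mk_injective (A := k) (B := AlgebraicClosure k) V
  have hqv : q v = 0 := by
    have h := hv v
    rw [QuadraticMap.polar_self, nsmul_eq_mul] at h
    exact (mul_eq_zero.mp h).resolve_left (by simpa using Invertible.ne_zero (2 : k))
  obtain ⟨w, hw⟩ := hq ((1 : AlgebraicClosure k) ⊗ₜ[k] v)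
    (fun h => hne (hinj (by simpa using h))) (by simp [hqv])
  apply hw
  let _ : Invertible (2 : AlgebraicClosure k) := invertibleOfNonzero fun h =>
    Invertible.ne_zero (2 : k) ((algebraMap k (AlgebraicClosure k)).injective
      (by rw [map_ofNat, h, map_zero]))
  rw [← QuadraticMap.polarBilin_apply_apply, QuadraticForm.polarBilin_baseChange]
  induction w with
  | zero => simp
  | add x y hx hy =>
    rw [map_add]
    by_cases h1 : LinearMap.BilinForm.baseChange (AlgebraicClosure k) q.polarBilin (1 ⊗ₜ[k] v) x = 0
    · by_cases h2 :
        LinearMap.BilinForm.baseChange (AlgebraicClosure k) q.polarBilin (1 ⊗ₜ[k] v) y = 0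
      · rw [h1, h2, add_zero]
      · refine absurd (hy ?_) h2
        rwa [← QuadraticMap.polarBilin_apply_apply, QuadraticForm.polarBilin_baseChange]
    · refine absurd (hx ?_) h1
      rwa [← QuadraticMap.polarBilin_apply_apply, QuadraticForm.polarBilin_baseChange]
  | tmul a x =>
    rw [LinearMap.BilinForm.baseChange_tmul, QuadraticMap.polarBilin_apply_apply, hv, zero_smul]

theorem IsSmooth.separatingLeft {q : QuadraticForm k V} (hq : IsSmooth q) :
    (QuadraticMap.associated (R := k) q).SeparatingLeft := by
  intro v hv
  refine hq.eq_zero fun w => ?_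
  have h := congr($(QuadraticMap.two_nsmul_associated k q) v w)
  rw [QuadraticMap.polarBilin_apply_apply] at h
  rw [← h, LinearMap.smul_apply, LinearMap.smul_apply, hv w, smul_zero]

end Smooth

section Polynomial

variable {k : Type*} [Field k] {n : ℕ}

/-- The homogeneous quadratic polynomial of a quadratic form on `k ^ n`. -/
noncomputable def toPolynomial [Invertible (2 : k)] (q : QuadraticForm k (Fin n → k)) :
    MvPolynomial (Fin n) k :=
  ∑ i, ∑ j, MvPolynomial.C (QuadraticMap.associated (R := k) q (Pi.single i 1) (Pi.single j 1)) *
    MvPolynomial.X i * MvPolynomial.X j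

theorem toPolynomial_isHomogeneous [Invertible (2 : k)] (q : QuadraticForm k (Fin n → k)) :
    (toPolynomial q).IsHomogeneous 2 := by
  refine MvPolynomial.IsHomogeneous.sum _ _ _ fun i _ =>
    MvPolynomial.IsHomogeneous.sum _ _ _ fun j _ => ?_
  exact ((MvPolynomial.isHomogeneous_C _ _).mul (MvPolynomial.isHomogeneous_X _ _)).mul
    (MvPolynomial.isHomogeneous_X _ _)

theorem eval_toPolynomial [Invertible (2 : k)] (q : QuadraticForm k (Fin n → k))
    (v : Fin n → k) : MvPolynomial.eval v (toPolynomial q) = q v := by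
  conv_rhs => rw [← QuadraticMap.associated_eq_self_apply k q v,
    ← LinearMap.sum_repr_mul_repr_mul (Pi.basisFun k (Fin n)) (Pi.basisFun k (Fin n))]
  simp only [toPolynomial, map_sum, map_mul, MvPolynomial.eval_C, MvPolynomial.eval_X]
  rw [Finsupp.sum_fintype _ _ (by simp)]
  refine Finset.sum_congr rfl fun i _ => ?_
  rw [Finsupp.sum_fintype _ _ (by simp)]
  refine Finset.sum_congr rfl fun j _ => ?_
  simp only [Pi.basisFun_repr, Pi.basisFun_apply, smul_eq_mul]
  ring

theorem exists_linear {A : MvPolynomial (Fin n) k} (hA : A.IsHomogeneous 1) :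
    ∃ l : (Fin n → k) →ₗ[k] k, ∀ v, MvPolynomial.eval v A = l v := by
  have hA' : A ∈ Submodule.span k (Set.range (MvPolynomial.X (R := k) (σ := Fin n))) := by
    rw [← MvPolynomial.homogeneousSubmodule_one_eq_span_X]
    exact hA
  induction hA' using Submodule.span_induction with
  | mem x h => obtain ⟨i, rfl⟩ := h; exact ⟨LinearMap.proj i, fun v => by simp⟩
  | zero => exact ⟨0, fun v => by simp⟩
  | add x y hx hy h1 h2 =>
    have key {z} (hz : z ∈ Submodule.span k (Set.range (MvPolynomial.X (R := k) (σ := Fin n)))) :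
        z.IsHomogeneous 1 := by
      rw [← MvPolynomial.homogeneousSubmodule_one_eq_span_X] at hz
      exact hz
    obtain ⟨l, hl⟩ := h1 (key hx)
    obtain ⟨m, hm⟩ := h2 (key hy)
    exact ⟨l + m, fun v => by simp [hl, hm]⟩
  | smul a x hx h =>
    rw [← MvPolynomial.homogeneousSubmodule_one_eq_span_X] at hx
    obtain ⟨l, hl⟩ := h hx
    exact ⟨a • l, fun v => by simp [hl]⟩

theorem exists_linear_factors {F A B : MvPolynomial (Fin n) k} (hF : F.IsHomogeneous 2)
    (hA : A.totalDegree = 1) (hB : B.totalDegree = 1) (h : F = A * B) :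
    ∃ l m : (Fin n → k) →ₗ[k] k, ∀ v, MvPolynomial.eval v F = l v * m v := by
  have split {A : MvPolynomial (Fin n) k} (hA : A.totalDegree = 1) :
      ∃ (a : k) (A₁ : MvPolynomial (Fin n) k), A₁.IsHomogeneous 1 ∧ A = MvPolynomial.C a + A₁ :=
    ⟨MvPolynomial.coeff 0 A, MvPolynomial.homogeneousComponent 1 A,
      MvPolynomial.homogeneousComponent_isHomogeneous _ _, by
      conv_lhs => rw [← MvPolynomial.sum_homogeneousComponent A, hA]
      simp [Finset.sum_range_succ]⟩
  obtain ⟨a, A₁, hA₁, rfl⟩ := split hA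
  obtain ⟨b, B₁, hB₁, rfl⟩ := split hB
  have e : F = A₁ * B₁ := by
    have h1 : F = MvPolynomial.C (a * b) + (MvPolynomial.C a * B₁ + MvPolynomial.C b * A₁) +
        A₁ * B₁ := by rw [h, map_mul]; ring
    have h2 := congr(MvPolynomial.homogeneousComponent 2 $h1)
    have g0 : (MvPolynomial.C (σ := Fin n) (a * b)).IsHomogeneous 0 :=
      MvPolynomial.isHomogeneous_C _ _
    have g1 : (MvPolynomial.C a * B₁ + MvPolynomial.C b * A₁).IsHomogeneous 1 :=
      (hB₁.C_mul a).add (hA₁.C_mul b)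
    have g2 : (A₁ * B₁).IsHomogeneous 2 := hA₁.mul hB₁
    rw [map_add, map_add, MvPolynomial.homogeneousComponent_of_mem hF,
      MvPolynomial.homogeneousComponent_of_mem g0, MvPolynomial.homogeneousComponent_of_mem g1,
      MvPolynomial.homogeneousComponent_of_mem g2] at h2
    simpa using h2
  obtain ⟨l, hl⟩ := exists_linear hA₁
  obtain ⟨m, hm⟩ := exists_linear hB₁
  exact ⟨l, m, fun v => by rw [e, map_mul, hl, hm]⟩

end Polynomial

/-- The Clifford invariant of the smooth conic `{q = 0}`, where `q` is a quadratic form in three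
variables: the Brauer class of the even Clifford algebra of `q`. -/
noncomputable def cliffordInvariant {k V : Type u} [Field k] [Invertible (2 : k)] [AddCommGroup V]
    [Module k V] (q : QuadraticForm k V) (h3 : Module.finrank k V = 3) (hq : IsSmooth q) :
    BrauerGroup.{u, u} k :=
  have := Module.finite_of_finrank_pos (R := k) (M := V) (by omega)
  have h := even_isCSA q h3 hq.separatingLeft
  Quotient.mk _ (BrauerGroup.mkCSA (CliffordAlgebra.even q) h.1 h.2.1 h.2.2)

end Quadric

open Quadric

/-- A quadric surface cone over a field of characteristic different from two, whose base is a
smooth conic: the quadric `{form = 0}` in `ℙ³`, where `form` is pulled back along the projection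
from `vertex` onto a complementary plane `plane`, and restricts to a form defining a smooth conic
in that plane. -/
structure QuadricSurfaceCone (k : Type u) [Field k] [Invertible (2 : k)] where
  /-- The quadratic form whose vanishing defines the cone in `ℙ³`. -/
  form : QuadraticForm k (Fin 4 → k)
  /-- The vertex of the cone. -/
  vertex : Projectivization k (Fin 4 → k)
  /-- The plane in `ℙ³` which contains the base of the cone. -/
  plane : Submodule k (Fin 4 → k)
  isCompl : IsCompl vertex.submodule plane
  form_add : ∀ v ∈ vertex.submodule, ∀ w ∈ plane, form (v + w) = form w
  smooth_base : IsSmooth (form.restrict plane)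

namespace QuadricSurfaceCone

variable {k : Type u} [Field k] [Invertible (2 : k)] (Q : QuadricSurfaceCone k)

theorem finrank_plane : Module.finrank k Q.plane = 3 := by
  have h := Submodule.finrank_add_eq_of_isCompl Q.isCompl
  rw [Projectivization.finrank_submodule, Module.finrank_fin_fun] at h
  omega

/-- The quadratic form of the base conic of the cone. -/
def base : QuadraticForm k Q.plane := Q.form.restrict Q.plane

theorem irreducible_toPolynomial : Irreducible (toPolynomial Q.form) := by
  have hno : ¬ ∃ l m : (Fin 4 → k) →ₗ[k] k, ∀ v, Q.form v = l v * m v := by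
    rintro ⟨l, m, h⟩
    obtain ⟨w, hw, hw0⟩ := Submodule.exists_mem_ne_zero_of_ne_bot
      (LinearMap.ker_ne_bot_of_finrank_lt (f := (l.prod m).domRestrict Q.plane) (by
        rw [Q.finrank_plane]; simp))
    refine hw0 (Q.smooth_base.eq_zero fun x => ?_)
    have hlm : l w = 0 ∧ m w = 0 := by simpa using hw
    simp [QuadraticMap.polar, h, hlm.1, hlm.2]
  have hF := toPolynomial_isHomogeneous Q.form
  have hF0 : toPolynomial Q.form ≠ 0 := fun h0 => hno ⟨0, 0, fun v => by
    rw [← eval_toPolynomial, h0]; simp⟩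
  have hdeg := hF.totalDegree hF0
  have hconst {A : MvPolynomial (Fin 4) k} (hA : A ≠ 0) (h : A.totalDegree = 0) : IsUnit A := by
    rw [MvPolynomial.totalDegree_eq_zero_iff_eq_C] at h
    rw [h] at hA ⊢
    exact (IsUnit.mk0 _ fun h0 => hA (by simp [h0])).map MvPolynomial.C
  refine ⟨fun hu => ?_, fun A B hAB => ?_⟩
  · rw [MvPolynomial.isUnit_iff_totalDegree_of_isReduced, hdeg] at hu
    exact absurd hu.2 (by norm_num)
  · have hA : A ≠ 0 := by rintro rfl; simp [hAB] at hF0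
    have hB : B ≠ 0 := by rintro rfl; simp [hAB] at hF0
    rw [hAB, MvPolynomial.totalDegree_mul_of_isDomain hA hB] at hdeg
    by_cases h0 : A.totalDegree = 0
    · exact Or.inl (hconst hA h0)
    by_cases h1 : B.totalDegree = 0
    · exact Or.inr (hconst hB h1)
    obtain ⟨l, m, h⟩ := exists_linear_factors hF (by omega) (by omega) hAB
    exact absurd ⟨l, m, fun v => by rw [← h, eval_toPolynomial]⟩ hno

/-- The homogeneous coordinate ring of the cone in `ℙ³`. -/
abbrev coordinateRing : Type u :=
  MvPolynomial (Fin 4) k ⧸ Ideal.span {toPolynomial Q.form}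

instance : IsDomain Q.coordinateRing :=
  have : (Ideal.span {toPolynomial Q.form}).IsPrime :=
    (Ideal.span_singleton_prime Q.irreducible_toPolynomial.ne_zero).mpr
      Q.irreducible_toPolynomial.prime
  Ideal.Quotient.isDomain _

/-- The image of a polynomial in the field of fractions of the homogeneous coordinate ring. -/
noncomputable def toFrac : MvPolynomial (Fin 4) k →ₐ[k] FractionRing Q.coordinateRing :=
  (IsScalarTower.toAlgHom k Q.coordinateRing (FractionRing Q.coordinateRing)).comp
    (Ideal.Quotient.mkₐ k _)

/-- The function field of the cone: the fractions `A / B`, where `A` and `B` are homogeneous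
polynomials of the same degree and `B` does not vanish identically on the cone. -/
noncomputable def functionField : IntermediateField k (FractionRing Q.coordinateRing) where
  carrier := {x | ∃ (d : ℕ) (A B : MvPolynomial (Fin 4) k), A.IsHomogeneous d ∧
    B.IsHomogeneous d ∧ Q.toFrac B ≠ 0 ∧ x = Q.toFrac A / Q.toFrac B}
  mul_mem' := by
    rintro _ _ ⟨d, A, B, hA, hB, h0, rfl⟩ ⟨e, A', B', hA', hB', h0', rfl⟩
    exact ⟨d + e, A * A', B * B', hA.mul hA', hB.mul hB', by simp [h0, h0'], by
      rw [map_mul, map_mul, div_mul_div_comm]⟩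
  add_mem' := by
    rintro _ _ ⟨d, A, B, hA, hB, h0, rfl⟩ ⟨e, A', B', hA', hB', h0', rfl⟩
    exact ⟨d + e, A * B' + B * A', B * B', (hA.mul hB').add (hB.mul hA'), hB.mul hB',
      by simp [h0, h0'], by
      rw [map_add, map_mul, map_mul, map_mul, div_add_div _ _ h0 h0']⟩
  algebraMap_mem' r :=
    ⟨0, MvPolynomial.C r, 1, MvPolynomial.isHomogeneous_C _ _, MvPolynomial.isHomogeneous_one _ _,
      by simp, by
      rw [map_one, div_one, ← MvPolynomial.algebraMap_eq, AlgHom.commutes]⟩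
  inv_mem' := by
    rintro _ ⟨d, A, B, hA, hB, h0, rfl⟩
    by_cases h : Q.toFrac A = 0
    · exact ⟨0, 0, 1, MvPolynomial.isHomogeneous_zero _ _ _, MvPolynomial.isHomogeneous_one _ _,
        by simp, by simp [h]⟩
    · exact ⟨d, B, A, hB, hA, h, by rw [inv_div]⟩

/-- The base conic is smooth. -/
theorem isSmooth_base : IsSmooth Q.base := Q.smooth_base

/-- The Clifford invariant of the base conic of the cone. -/
noncomputable def baseCliffordInvariant : BrauerGroup.{u, u} k :=
  cliffordInvariant Q.base Q.finrank_plane Q.isSmooth_base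

end QuadricSurfaceCone

/-!
Let `X, Y, Z, T` be linear coordinates in which the cone is `Z ^ 2 = a X ^ 2 + b Y ^ 2`; then the
Clifford invariant of the base is the class of the quaternion algebra `(a, b)`
(`QuadricSurfaceCone.exists_coordinates`). This class has order at most two, because conjugation
identifies `(a, b)` with its opposite, and it dies in the function field of the cone, because the
point `(X / Y : 1 : Z / Y)` of the conic gives zero divisors in `(a, b)`
(`BrauerGroup.mk_quaternionCSA_eq_one`).

For the converse, the function field may be replaced by the larger field `Ω` of fractions of the
homogeneous coordinate ring. It is the function field `E(x, y)`, `y ^ 2 = a x ^ 2 + b`, of the conic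
over the field `E = k(Y, T)`. As `E` is purely transcendental over `k`, the map `Br(k) → Br(E)` is
injective: division algebras stay division algebras over `E`
(`BrauerGroup.restrict_injective_of_transcendental`). So the kernel of `Br(E) → Br(Ω)` remains, and
this is Amitsur's theorem for conics (`BrauerGroup.eq_one_or_eq_mk_quaternionCSA_of_conic`).

A division algebra `D` of dimension `n ^ 2` over `E` that is split by `Ω` acts on `Ω ^ n`. The
division algebra `E(x) ⊗ D` embeds into this space of dimension at most `2 n` over `E(x)`, so that
`n ≤ 2`. If `n = 2`, the embedding is bijective, and multiplication by `y` on `Ω ^ 2` yields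
`θ ∈ E(x) ⊗ D` with `θ ^ 2 = a x ^ 2 + b`. Since `D[x]` is a principal right ideal ring, the right
ideal generated by `1` and `θ` is `m D[x]` for some `m`, and `m⁻¹ θ m` is a polynomial with the same
square as `θ` (`Polynomial.exists_mul_self_eq`). By degree it has the form `u x + v`, and
comparison of coefficients gives `u ^ 2 = a`, `v ^ 2 = b` and `u v = - v u`. Hence `D` is the
quaternion algebra `(a, b)`.
-/

/-! ### Square roots in polynomial rings over division rings -/

section SquareRoot

open Polynomial

variable {D : Type*} [DivisionRing D]

/-- Polynomials over a division ring form a principal right ideal ring; here for the right ideal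
generated by two elements. -/
theorem Polynomial.exists_generator_of_pair (c P : D[X]) (hc : c ≠ 0) :
    ∃ m : D[X], m ≠ 0 ∧ (∃ A B, m = c * A + P * B) ∧ ∀ A B, ∃ G, c * A + P * B = m * G := by
  classical
  obtain ⟨m₀, ⟨hm₀, A₀, B₀, hAB₀⟩, hmin⟩ := exists_minimalFor_of_wellFoundedLT
    (fun m : D[X] => m ≠ 0 ∧ ∃ A B, m = c * A + P * B) natDegree ⟨c, hc, 1, 0, by simp⟩
  -- division with remainder is available for monic divisors only
  have hmon : (m₀ * C m₀.leadingCoeff⁻¹).Monic := monic_mul_leadingCoeff_inv hm₀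
  have hdeg : (m₀ * C m₀.leadingCoeff⁻¹).natDegree = m₀.natDegree :=
    natDegree_mul_C (inv_ne_zero (leadingCoeff_ne_zero.mpr hm₀))
  obtain ⟨A₁, B₁, hm⟩ : ∃ A B, m₀ * C m₀.leadingCoeff⁻¹ = c * A + P * B :=
    ⟨A₀ * C m₀.leadingCoeff⁻¹, B₀ * C m₀.leadingCoeff⁻¹, by
      rw [← mul_assoc, ← mul_assoc, ← add_mul, ← hAB₀]⟩
  generalize m₀ * C m₀.leadingCoeff⁻¹ = m at *
  refine ⟨m, hmon.ne_zero, ⟨A₁, B₁, hm⟩, fun A B => ⟨(c * A + P * B) /ₘ m, ?_⟩⟩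
  have hdiv := modByMonic_add_div (c * A + P * B) m
  suffices h0 : (c * A + P * B) %ₘ m = 0 by
    rw [h0, zero_add] at hdiv
    exact hdiv.symm
  by_contra hne
  have hlt := natDegree_modByMonic_lt (c * A + P * B) hmon (fun h1 => hne (by simp [h1]))
  refine absurd (hmin ⟨hne, A - A₁ * ((c * A + P * B) /ₘ m),
    B - B₁ * ((c * A + P * B) /ₘ m), ?_⟩ (by omega)) (by omega)
  rw [eq_sub_of_add_eq hdiv]
  generalize (c * A + P * B) /ₘ m = S
  rw [hm]
  noncomm_ring

/-- If a central polynomial `f` becomes a square after multiplication by the square of a central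
polynomial `c`, then `f` is a square. If `θ = P / c` is the square root of `f` and `m` generates
the right ideal spanned by `1` and `θ`, then `θ * m = m * G` for a polynomial `G`, and `G` is
conjugate to `θ`. -/
theorem Polynomial.exists_mul_self_eq {P c f : D[X]} (hc : c ≠ 0) (hc' : ∀ Q, Commute c Q)
    (hf : ∀ Q, Commute f Q) (h : P * P = c * c * f) : ∃ G : D[X], G * G = f := by
  obtain ⟨m, hm, ⟨A, B, hAB⟩, hgen⟩ := exists_generator_of_pair c P hc
  obtain ⟨G, hG⟩ := hgen (f * B) A
  have h1 : P * m = c * (m * G) := by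
    rw [← hG, hAB, mul_add, mul_add, ← mul_assoc P c, ← (hc' P).eq, ← mul_assoc P P, h]
    noncomm_ring
  have h2 : c * c * (f * m) = c * c * (m * (G * G)) := by
    calc c * c * (f * m) = P * (P * m) := by rw [← mul_assoc, ← h, mul_assoc]
      _ = c * P * (m * G) := by rw [h1, ← mul_assoc, ← (hc' P).eq]
      _ = c * (P * m * G) := by noncomm_ring
      _ = _ := by rw [h1]; noncomm_ring
  have h3 := mul_left_cancel₀ (mul_ne_zero hc hc) h2
  rw [(hf m).eq] at h3
  exact ⟨G, (mul_left_cancel₀ hm h3).symm⟩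

/-- A square root in `D[X]` of `a X ^ 2 + b` is linear, and its coefficients anticommute. -/
theorem Polynomial.exists_anticommuting_of_mul_self_eq {a b : D} (ha : a ≠ 0) {G : D[X]}
    (hG : G * G = C a * X ^ 2 + C b) : ∃ u v : D, u * u = a ∧ v * v = b ∧ u * v = -(v * u) := by
  have hdeg : (G * G).natDegree = 2 := by
    rw [hG]
    simpa using natDegree_quadratic (b := 0) (c := b) ha
  have hG0 : G ≠ 0 := by rintro rfl; simp at hdeg
  rw [natDegree_mul hG0 hG0] at hdeg
  obtain ⟨u, v, rfl⟩ := exists_eq_X_add_C_of_natDegree_le_one (p := G) (by omega)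
  have e : (C u * X + C v) * (C u * X + C v) =
      C (u * u) * X ^ 2 + C (u * v + v * u) * X + C (v * v) := by
    have h1 : (X : D[X]) * C u = C u * X := (commute_X (C u)).eq
    have h2 : (X : D[X]) * C v = C v * X := (commute_X (C v)).eq
    calc _ = C u * (X * C u) * X + C u * (X * C v) + C v * C u * X + C v * C v := by noncomm_ring
      _ = _ := by
        rw [h1, h2, map_add, map_mul, map_mul, map_mul, map_mul]
        noncomm_ring
  rw [e] at hG
  have c0 := congr(coeff $hG 0)
  have c1 := congr(coeff $hG 1)
  have c2 := congr(coeff $hG 2)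
  simp only [coeff_add, coeff_C_mul, coeff_X_pow, coeff_X, coeff_C] at c0 c1 c2
  norm_num at c0 c1 c2
  exact ⟨u, v, c2, c0, eq_neg_of_add_eq_zero_left c1⟩

end SquareRoot

/-! ### Division algebras over a simple transcendental extension -/

section EvalTensor

open Polynomial

variable {E F : Type*} (D : Type*) [Field E] [Field F] [Algebra E F] [DivisionRing D] [Algebra E D]

/-- The homomorphism from `D[X]` to the extension of scalars of `D` to `F`, which sends `X`
to `x`. -/
noncomputable def evalTensor (x : F) : D[X] →ₐ[E] F ⊗[E] D :=
  (Algebra.TensorProduct.comm E D F).toAlgHom.comp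
    ((Algebra.TensorProduct.map (AlgHom.id E D) (aeval x)).comp (polyEquivTensor E D).toAlgHom)

theorem evalTensor_C (x : F) (d : D) : evalTensor (E := E) D x (C d) = 1 ⊗ₜ d := by
  simp [evalTensor, polyEquivTensor_apply]

theorem evalTensor_X (x : F) : evalTensor (E := E) D x X = x ⊗ₜ 1 := by
  simp [evalTensor, polyEquivTensor_apply]

theorem evalTensor_map (x : F) (p : E[X]) :
    evalTensor (E := E) D x (p.map (algebraMap E D)) = aeval x p ⊗ₜ 1 := by
  induction p using Polynomial.induction_on' with
  | add p q hp hq => simp [hp, hq, TensorProduct.add_tmul]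
  | monomial n a =>
    rw [map_monomial, ← C_mul_X_pow_eq_monomial, map_mul, map_pow, evalTensor_C, evalTensor_X,
      ← C_mul_X_pow_eq_monomial]
    simp [Algebra.algebraMap_eq_smul_one, TensorProduct.smul_tmul']

variable {D} in
theorem evalTensor_injective {x : F} (hx : Transcendental E x) :
    Function.Injective (evalTensor (E := E) D x) := by
  have h1 : Function.Injective (Algebra.TensorProduct.map (AlgHom.id E D) (aeval (R := E) x)) :=
    Module.Flat.lTensor_preserves_injective_linearMap (M := D) (aeval (R := E) x).toLinearMap
      (transcendental_iff_injective.mp hx)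
  exact (Algebra.TensorProduct.comm E D F).injective.comp
    (h1.comp (polyEquivTensor E D).injective)

variable {D} in
/-- The elements of `E(x) ⊗ D` are the quotients of polynomials in `x` with coefficients in `D`
by polynomials in `x` with coefficients in `E`. -/
theorem exists_smul_eq_evalTensor {x : F} (hx : ∀ y : F, ∃ p q : E[X], y = aeval x p / aeval x q)
    (θ : F ⊗[E] D) :
    ∃ (q : E[X]) (P : D[X]), aeval x q ≠ 0 ∧ aeval x q • θ = evalTensor (E := E) D x P := by
  induction θ with
  | zero => exact ⟨1, 0, by simp, by simp⟩
  | tmul y d =>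
    obtain ⟨p, q, rfl⟩ := hx y
    by_cases hq : aeval x q = 0
    · exact ⟨1, 0, by simp, by simp [hq]⟩
    · refine ⟨q, p.map (algebraMap E D) * C d, hq, ?_⟩
      rw [map_mul, evalTensor_map, evalTensor_C, TensorProduct.smul_tmul', smul_eq_mul,
        mul_div_cancel₀ _ hq]
      simp
  | add θ η h1 h2 =>
    obtain ⟨q, P, hq, hP⟩ := h1
    obtain ⟨r, R, hr, hR⟩ := h2
    refine ⟨q * r, r.map (algebraMap E D) * P + q.map (algebraMap E D) * R, by simp [hq, hr], ?_⟩
    have key (f : F) (z : F ⊗[E] D) : f ⊗ₜ[E] (1 : D) * z = f • z := by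
      rw [Algebra.smul_def, Algebra.TensorProduct.algebraMap_apply]
      rfl
    rw [map_add, map_mul _ (r.map _), map_mul _ (q.map _), evalTensor_map, evalTensor_map, ← hP,
      ← hR, key, key, map_mul, smul_add, smul_smul, smul_smul, mul_comm (aeval x r)]

variable {D} in
theorem isDomain_tensorProduct_of_transcendental {x : F} (ht : Transcendental E x)
    (hx : ∀ y : F, ∃ p q : E[X], y = aeval x p / aeval x q) : IsDomain (F ⊗[E] D) := by
  have : Nontrivial (F ⊗[E] D) := (evalTensor_injective (D := D) ht).nontrivial
  have : NoZeroDivisors (F ⊗[E] D) := ⟨fun {θ η} h => by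
    obtain ⟨q, P, hq, hP⟩ := exists_smul_eq_evalTensor hx θ
    obtain ⟨r, R, hr, hR⟩ := exists_smul_eq_evalTensor hx η
    have h0 : evalTensor (E := E) D x (P * R) = 0 := by
      rw [map_mul, ← hP, ← hR, smul_mul_smul_comm, h, smul_zero]
    rw [map_eq_zero_iff _ (evalTensor_injective ht), mul_eq_zero] at h0
    rcases h0 with rfl | rfl
    · exact Or.inl ((smul_eq_zero_iff_right hq).mp (by simpa using hP))
    · exact Or.inr ((smul_eq_zero_iff_right hr).mp (by simpa using hR))⟩
  exact NoZeroDivisors.to_isDomain _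

variable {D} in
/-- If `a x ^ 2 + b` becomes a square in `E(x) ⊗ D`, then `D` contains anticommuting square roots
of `a` and `b`. -/
theorem exists_anticommuting_of_tensorProduct {x : F} (ht : Transcendental E x)
    (hx : ∀ y : F, ∃ p q : E[X], y = aeval x p / aeval x q) {a b : E} (ha : a ≠ 0)
    {θ : F ⊗[E] D} (hθ : θ * θ = (algebraMap E F a * x ^ 2 + algebraMap E F b) ⊗ₜ[E] 1) :
    ∃ u v : D, u * u = algebraMap E D a ∧ v * v = algebraMap E D b ∧ u * v = -(v * u) := by
  obtain ⟨q, P, hq, hP⟩ := exists_smul_eq_evalTensor hx θ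
  have hcomm (r : E[X]) (Q : D[X]) : Commute (r.map (algebraMap E D)) Q := by
    apply evalTensor_injective (D := D) ht
    rw [map_mul, map_mul, evalTensor_map]
    have h := Algebra.commutes (R := F) (A := F ⊗[E] D) (aeval x r) (evalTensor D x Q)
    rw [Algebra.TensorProduct.algebraMap_apply, Algebra.algebraMap_self_apply] at h
    rw [h]
  have hf : algebraMap E F a * x ^ 2 + algebraMap E F b =
      aeval x (C a * X ^ 2 + C b) := by simp
  have hq0 : q.map (algebraMap E D) ≠ 0 := by
    rw [Polynomial.map_ne_zero_iff (algebraMap E D).injective]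
    rintro rfl
    simp at hq
  have hsq : P * P = q.map (algebraMap E D) * q.map (algebraMap E D) *
      (C a * X ^ 2 + C b).map (algebraMap E D) := by
    apply evalTensor_injective (D := D) ht
    rw [map_mul, ← hP, map_mul, map_mul, evalTensor_map, evalTensor_map, smul_mul_smul_comm, hθ,
      hf, TensorProduct.smul_tmul', Algebra.TensorProduct.tmul_mul_tmul,
      Algebra.TensorProduct.tmul_mul_tmul, mul_one, mul_one, smul_eq_mul]
  obtain ⟨G, hG⟩ := exists_mul_self_eq hq0 (hcomm q) (hcomm _) hsq
  refine exists_anticommuting_of_mul_self_eq (a := algebraMap E D a) (b := algebraMap E D b)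
    (by simpa using ha) (G := G) ?_
  rw [hG]
  simp

end EvalTensor

/-! ### Split algebras and representations of small dimension -/

section Split

/-- A finite-dimensional algebra without zero divisors embeds into each of its nonzero
representations. -/
theorem injective_apply_of_isDomain {F Δ V : Type*} [Field F] [Ring Δ] [IsDomain Δ] [Algebra F Δ]
    [FiniteDimensional F Δ] [AddCommGroup V] [Module F V] (φ : Δ →ₐ[F] Module.End F V)
    {v : V} (hv : v ≠ 0) : Function.Injective fun d => φ d v := by
  have key (d : Δ) (h : φ d v = 0) : d = 0 := by
    by_contra hd
    obtain ⟨u, rfl⟩ := FiniteDimensional.isUnit F hd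
    apply hv
    have := congr(φ (↑u⁻¹ : Δ) $h)
    rwa [← Module.End.mul_apply, ← map_mul, Units.inv_mul, map_one, map_zero] at this
  intro d e h
  exact sub_eq_zero.mp (key _ (by simpa [sub_eq_zero] using h))

/-- If the matrices of size `p` over `B` form a matrix algebra of size `q` over `K`, then
the image of an elementary idempotent is a representation of `B` of dimension `q / p`. -/
theorem exists_algHom_end_of_matrix_algEquiv {K B : Type*} [Field K] [Ring B] [Algebra K B]
    [FiniteDimensional K B] {p q : ℕ} (hp : p ≠ 0)
    (e : Matrix (Fin p) (Fin p) B ≃ₐ[K] Matrix (Fin q) (Fin q) K) :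
    ∃ n : ℕ, n ^ 2 = Module.finrank K B ∧
      Nonempty (B →ₐ[K] Module.End K (Fin n → K)) := by
  classical
  let φ : Matrix (Fin p) (Fin p) B →ₐ[K] Module.End K (Fin q → K) :=
    (Matrix.toLinAlgEquiv' (R := K)).toAlgHom.comp e.toAlgHom
  let o : Fin p := ⟨0, Nat.pos_of_ne_zero hp⟩
  let s (i j : Fin p) (b : B) : Module.End K (Fin q → K) := φ (Matrix.single i j b)
  have hs (i j l : Fin p) (b c : B) (v) : s i j b (s j l c v) = s i l (b * c) v := by
    simp only [s, ← Module.End.mul_apply, ← map_mul, Matrix.single_mul_single_same]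
  have hs0 (i j j' l : Fin p) (h : j ≠ j') (b c : B) (v) : s i j b (s j' l c v) = 0 := by
    simp only [s, ← Module.End.mul_apply, ← map_mul, Matrix.single_mul_single_of_ne _ _ _ _ h,
      map_zero, LinearMap.zero_apply]
  have hsum (v) : ∑ i, s i i 1 v = v := by
    have : ∑ i, Matrix.single i i (1 : B) = (1 : Matrix (Fin p) (Fin p) B) := by
      ext i j
      rw [Matrix.sum_apply, Finset.sum_eq_single i (by simp +contextual) (by simp)]
      simp [Matrix.single_apply, Matrix.one_apply]
    have h := congr(φ $this v)
    simpa [s] using h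
  -- the maps `s o i 1` identify the representation with `p` copies of the image `W` of `s o o 1`
  let W := LinearMap.range (s o o 1)
  have hW {w} (hw : w ∈ W) : s o o 1 w = w := by
    obtain ⟨v, rfl⟩ := hw
    rw [hs, one_mul]
  have hmem (j : Fin p) (b : B) (v) : s o j b v ∈ W := ⟨s o j b v, by rw [hs, one_mul]⟩
  let Φ : (Fin q → K) ≃ₗ[K] (Fin p → W) :=
    { toFun := fun v i => ⟨s o i 1 v, hmem _ _ _⟩
      map_add' := fun v w => by ext; simp
      map_smul' := fun c v => by ext; simp
      invFun := fun w => ∑ i, s i o 1 (w i)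
      left_inv := fun v => by simp [hs, hsum]
      right_inv := fun w => by
        ext i : 2
        simp only [map_sum]
        rw [Finset.sum_eq_single i (fun j _ hj => hs0 _ _ _ _ hj.symm _ _ _) (by simp), hs,
          one_mul, hW (w i).2] }
  have hq : q = p * Module.finrank K W := by
    simpa [Module.finrank_pi_fintype] using Φ.finrank_eq
  have hdim : p ^ 2 * Module.finrank K B = q ^ 2 := by
    have := e.toLinearEquiv.finrank_eq
    simp only [Module.finrank_matrix, Fintype.card_fin, Module.finrank_self] at this
    rw [sq, sq, this, mul_one]
  refine ⟨Module.finrank K W, ?_, ⟨?_⟩⟩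
  · rw [hq, mul_pow] at hdim
    exact (Nat.eq_of_mul_eq_mul_left (by positivity) hdim).symm
  · let ψ : B →ₐ[K] Module.End K W := AlgHom.ofLinearMap
      { toFun := fun b => (s o o b).restrict fun w _ => hmem _ _ _
        map_add' := fun b c => by ext; simp [s, Matrix.single_add]
        map_smul' := fun r b => by ext; simp [s, ← Matrix.smul_single] }
      (by
        ext w : 2
        simp [hW w.2])
      (fun b c => by
        ext w : 2
        simp [hs])
    exact (LinearEquiv.conjAlgEquiv K (Module.finBasis K W).equivFun).toAlgHom.comp ψ

end Split

/-! ### Brauer classes of division algebras -/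

namespace BrauerGroup

open Polynomial IntermediateField

section Classes

variable {k : Type u} [Field k]

/-- The Brauer class of a central simple algebra. -/
abbrev mk (A : CSA.{u, u} k) : BrauerGroup.{u, u} k := Quotient.mk (Brauer.CSA_Setoid k) A

theorem mk_eq_of_algEquiv {A B : CSA.{u, u} k} (e : A ≃ₐ[k] B) : mk A = mk B :=
  Quotient.sound (equivalent_of_algEquiv e)

/-- The isomorphism of the matrices of size one with the ring of their entries. -/
def finOneMatrixAlgEquiv (A : Type*) [Ring A] [Algebra k A] : Matrix (Fin 1) (Fin 1) A ≃ₐ[k] A :=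
  (Matrix.reindexAlgEquiv k A (Equiv.ofUnique (Fin 1) Unit)).trans
    (Matrix.uniqueAlgEquiv (m := Unit))

theorem mk_eq_of_algEquiv_matrix {A B : CSA.{u, u} k} {n : ℕ} (hn : n ≠ 0)
    (e : A ≃ₐ[k] Matrix (Fin n) (Fin n) B) : mk A = mk B :=
  Quotient.sound ⟨1, n, one_ne_zero, hn, ⟨(finOneMatrixAlgEquiv A).trans e⟩⟩

/-- A homomorphism from a simple algebra to an algebra of the same dimension is an isomorphism. -/
noncomputable def algEquivOfFinrankEq {A B : Type*} [Ring A] [Algebra k A] [IsSimpleRing A]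
    [Ring B] [Nontrivial B] [Algebra k B] [FiniteDimensional k A] [FiniteDimensional k B]
    (f : A →ₐ[k] B) (h : Module.finrank k A = Module.finrank k B) : A ≃ₐ[k] B :=
  AlgEquiv.ofBijective f ⟨f.toRingHom.injective,
    (LinearMap.injective_iff_surjective_of_finrank_eq_finrank (f := f.toLinearMap) h).mp
      f.toRingHom.injective⟩

theorem mk_eq_one_of_finrank_eq_one (A : CSA.{u, u} k) (h : Module.finrank k A = 1) :
    mk A = 1 :=
  (mk_eq_of_algEquiv (A := unitCSA k) (B := A)
    (algEquivOfFinrankEq (Algebra.ofId k A) (by rw [h, Module.finrank_self]))).symm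

/-- Every Brauer class is the class of a central division algebra. -/
theorem exists_divisionRing (c : BrauerGroup.{u, u} k) :
    ∃ (D : Type u) (_ : DivisionRing D) (_ : Algebra k D) (h₁ : Algebra.IsCentral k D)
      (h₃ : FiniteDimensional k D), c = mk (mkCSA D h₁ inferInstance h₃) := by
  obtain ⟨A, rfl⟩ := Quotient.exists_rep c
  have : IsArtinianRing A := IsArtinianRing.of_finite k A
  obtain ⟨n, hn, D, hD, hkD, hfin, ⟨e⟩⟩ :=
    IsSimpleRing.exists_algEquiv_matrix_divisionRing_finite k A
  have h1 : Algebra.IsCentral k (D ⊗[k] Matrix (Fin n) (Fin n) k) :=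
    .of_algEquiv k _ _ (e.trans (matrixEquivTensor (Fin n) k D))
  have h2 : Algebra.IsCentral k D :=
    Algebra.IsCentral.left_of_tensor_of_field k D (Matrix (Fin n) (Fin n) k)
  exact ⟨D, hD, hkD, h2, hfin, mk_eq_of_algEquiv_matrix hn.out e⟩

/-- A central simple algebra of dimension four with zero divisors is split. -/
theorem mk_eq_one_of_finrank_eq_four (A : CSA.{u, u} k) (h : Module.finrank k A = 4) {x y : A}
    (hx : x ≠ 0) (hy : y ≠ 0) (hxy : x * y = 0) : mk A = 1 := by
  have : IsArtinianRing A := IsArtinianRing.of_finite k A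
  obtain ⟨n, hn, D, hD, hkD, hfin, ⟨e⟩⟩ :=
    IsSimpleRing.exists_algEquiv_matrix_divisionRing_finite k A
  have h1 : Algebra.IsCentral k (D ⊗[k] Matrix (Fin n) (Fin n) k) :=
    .of_algEquiv k _ _ (e.trans (matrixEquivTensor (Fin n) k D))
  have h2 : Algebra.IsCentral k D :=
    Algebra.IsCentral.left_of_tensor_of_field k D (Matrix (Fin n) (Fin n) k)
  have hcard : n * n * Module.finrank k D = 4 := by
    rw [← h, e.toLinearEquiv.finrank_eq, Module.finrank_matrix]
    simp
  have hn1 : n ≠ 1 := by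
    rintro rfl
    have e' := e.trans (finOneMatrixAlgEquiv D)
    have h0 : e' x * e' y = 0 := by rw [← map_mul, hxy, map_zero]
    rcases mul_eq_zero.mp h0 with h0 | h0
    · exact hx (e'.injective (by rw [h0, map_zero]))
    · exact hy (e'.injective (by rw [h0, map_zero]))
  have hn0 := hn.out
  have hD1 : Module.finrank k D = 1 := by
    have hpos : 0 < Module.finrank k D := Module.finrank_pos
    have : 2 * 2 ≤ n * n := Nat.mul_le_mul (by omega) (by omega)
    nlinarith
  rw [mk_eq_of_algEquiv_matrix (B := mkCSA D h2 inferInstance hfin) hn.out e]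
  exact mk_eq_one_of_finrank_eq_one _ hD1

/-- A split algebra of dimension `n ^ 2` has a representation of dimension `n`. -/
theorem exists_algHom_end_of_mk_eq_one {A : CSA.{u, u} k} (h : mk A = 1) :
    ∃ n : ℕ, n ^ 2 = Module.finrank k A ∧ Nonempty (A →ₐ[k] Module.End k (Fin n → k)) := by
  obtain ⟨p, q, hp, -, ⟨e⟩⟩ : IsBrauerEquivalent A (unitCSA k) := Quotient.exact h
  exact exists_algHom_end_of_matrix_algEquiv hp e

end Classes

section Restrict

variable (k E Ω : Type u) [Field k] [Field E] [Field Ω] [Algebra k E]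

theorem restrict_mk (A : CSA.{u, u} k) : restrict k E (mk A) = mk (extend E A) := rfl

variable [Algebra E Ω] [Algebra k Ω] [IsScalarTower k E Ω]

theorem restrict_restrict (c : BrauerGroup.{u, u} k) :
    restrict E Ω (restrict k E c) = restrict k Ω c := by
  obtain ⟨A, rfl⟩ := Quotient.exists_rep c
  let f : Ω ⊗[E] (E ⊗[k] A) →ₐ[Ω] Ω ⊗[k] A :=
    Algebra.TensorProduct.lift Algebra.TensorProduct.includeLeft
      (Algebra.TensorProduct.map (Algebra.ofId E Ω) (AlgHom.id k A))
      fun r z => by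
        have h := Algebra.commutes (A := Ω ⊗[k] A) r
          (Algebra.TensorProduct.map (Algebra.ofId E Ω) (AlgHom.id k A) z)
        rwa [Algebra.TensorProduct.algebraMap_apply] at h
  have : IsSimpleRing (Ω ⊗[E] (E ⊗[k] A)) := (extend Ω (extend E A)).isSimple
  have : IsSimpleRing (Ω ⊗[k] A) := (extend Ω A).isSimple
  let e : Ω ⊗[E] (E ⊗[k] A) ≃ₐ[Ω] Ω ⊗[k] A :=
    algEquivOfFinrankEq f (by simp only [Module.finrank_baseChange])
  exact mk_eq_of_algEquiv (A := extend Ω (extend E A)) (B := extend Ω A) e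

variable {k E} in
/-- A purely transcendental extension of degree one does not split any nontrivial class: it keeps
division algebras without zero divisors. -/
theorem restrict_injective_of_transcendental {x : E} (ht : Transcendental k x)
    (hx : ∀ y : E, ∃ p q : k[X], y = aeval x p / aeval x q) :
    Function.Injective (restrict k E) := by
  rw [injective_iff_map_eq_one]
  intro c hc
  obtain ⟨D, _, _, h₁, h₃, rfl⟩ := exists_divisionRing c
  rw [restrict_mk] at hc
  obtain ⟨n, hn, ⟨φ⟩⟩ := exists_algHom_end_of_mk_eq_one hc
  have hdom : IsDomain (E ⊗[k] D) := isDomain_tensorProduct_of_transcendental ht hx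
  have hn' : n ^ 2 = Module.finrank k D := hn.trans Module.finrank_baseChange
  have hpos : 0 < Module.finrank k D := Module.finrank_pos
  have hn0 : 0 < n := Nat.pos_of_ne_zero (by rintro rfl; simp at hn'; omega)
  have hle : n ^ 2 ≤ n := by
    have hv : (fun _ => 1 : Fin n → E) ≠ 0 := fun h => one_ne_zero congr($h ⟨0, hn0⟩)
    have hinj := injective_apply_of_isDomain φ hv
    have := LinearMap.finrank_le_finrank_of_injective
      (f := (LinearMap.applyₗ (fun _ => 1 : Fin n → E)).comp φ.toLinearMap) hinj
    rw [Module.finrank_fin_fun] at this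
    rw [hn]
    exact this
  refine mk_eq_one_of_finrank_eq_one _ ?_
  change Module.finrank k D = 1
  rw [← hn']
  have : n = 1 := by nlinarith
  rw [this, one_pow]

end Restrict

end BrauerGroup

/-! ### Quaternion algebras and function fields of conics -/

namespace BrauerGroup

open Polynomial IntermediateField

section Quaternion

variable {k : Type u} [Field k] {a b : k}

/-- The quaternion algebra `(a, b)` as a central simple algebra. -/
abbrev quaternionCSA (h2 : (2 : k) ≠ 0) (ha : a ≠ 0) (hb : b ≠ 0) : CSA.{u, u} k :=
  mkCSA ℍ[k,a,0,b] (QuaternionAlgebra.isCentral h2 ha) (QuaternionAlgebra.isSimpleRing h2 ha hb)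
    inferInstance

/-- A central simple algebra of dimension four which contains anticommuting square roots of `a` and
`b` is the quaternion algebra `(a, b)`. -/
theorem mk_eq_mk_quaternionCSA (h2 : (2 : k) ≠ 0) (ha : a ≠ 0) (hb : b ≠ 0) (C : CSA.{u, u} k)
    (h4 : Module.finrank k C = 4) {u v : C} (hu : u * u = algebraMap k C a)
    (hv : v * v = algebraMap k C b) (huv : u * v = -(v * u)) :
    mk C = mk (quaternionCSA h2 ha hb) := by
  let B : QuaternionAlgebra.Basis C a 0 b :=
    { i := u
      j := v
      k := u * v
      i_mul_i := by rw [hu, Algebra.algebraMap_eq_smul_one, zero_smul, add_zero]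
      j_mul_j := by rw [hv, Algebra.algebraMap_eq_smul_one]
      i_mul_j := rfl
      j_mul_i := by rw [huv, zero_smul, zero_sub, neg_neg] }
  have := QuaternionAlgebra.isSimpleRing h2 ha hb
  exact (mk_eq_of_algEquiv (A := quaternionCSA h2 ha hb) (B := C)
    (algEquivOfFinrankEq B.liftHom (by rw [h4, QuaternionAlgebra.finrank_eq_four]))).symm

theorem restrict_mk_quaternionCSA (E : Type u) [Field E] [Algebra k E] (h2 : (2 : k) ≠ 0)
    (ha : a ≠ 0) (hb : b ≠ 0) (h2' : (2 : E) ≠ 0) (ha' : algebraMap k E a ≠ 0)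
    (hb' : algebraMap k E b ≠ 0) :
    restrict k E (mk (quaternionCSA h2 ha hb)) = mk (quaternionCSA h2' ha' hb') := by
  have hi : (⟨0, 1, 0, 0⟩ : ℍ[k,a,0,b]) * ⟨0, 1, 0, 0⟩ = algebraMap k _ a := by ext <;> simp
  have hj : (⟨0, 0, 1, 0⟩ : ℍ[k,a,0,b]) * ⟨0, 0, 1, 0⟩ = algebraMap k _ b := by ext <;> simp
  have hij : (⟨0, 1, 0, 0⟩ : ℍ[k,a,0,b]) * ⟨0, 0, 1, 0⟩ =
      -((⟨0, 0, 1, 0⟩ : ℍ[k,a,0,b]) * ⟨0, 1, 0, 0⟩) := by ext <;> simp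
  have hmap (r : k) : (1 : E) ⊗ₜ[k] algebraMap k ℍ[k,a,0,b] r =
      algebraMap E (E ⊗[k] ℍ[k,a,0,b]) (algebraMap k E r) := by
    rw [Algebra.TensorProduct.algebraMap_apply, Algebra.algebraMap_self_apply,
      Algebra.algebraMap_eq_smul_one, Algebra.algebraMap_eq_smul_one, TensorProduct.smul_tmul]
  refine mk_eq_mk_quaternionCSA h2' ha' hb' (extend E (quaternionCSA h2 ha hb))
    (Module.finrank_baseChange.trans (QuaternionAlgebra.finrank_eq_four _ _ _))
    (u := (1 : E) ⊗ₜ[k] (⟨0, 1, 0, 0⟩ : ℍ[k,a,0,b]))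
    (v := (1 : E) ⊗ₜ[k] (⟨0, 0, 1, 0⟩ : ℍ[k,a,0,b]))
    ?_ ?_ ?_
  · rw [Algebra.TensorProduct.tmul_mul_tmul, hi, one_mul, hmap]
  · rw [Algebra.TensorProduct.tmul_mul_tmul, hj, one_mul, hmap]
  · rw [Algebra.TensorProduct.tmul_mul_tmul, Algebra.TensorProduct.tmul_mul_tmul, hij,
      TensorProduct.tmul_neg]

/-- Conjugation identifies a quaternion algebra with its opposite, so that its class has order at
most two. -/
theorem mk_quaternionCSA_sq (h2 : (2 : k) ≠ 0) (ha : a ≠ 0) (hb : b ≠ 0) :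
    mk (quaternionCSA h2 ha hb) ^ 2 = 1 := by
  have h : mk (quaternionCSA h2 ha hb) = (mk (quaternionCSA h2 ha hb))⁻¹ :=
    mk_eq_of_algEquiv (A := quaternionCSA h2 ha hb) (B := opposite (quaternionCSA h2 ha hb))
      QuaternionAlgebra.starAe
  rw [sq]
  nth_rw 1 [h]
  exact inv_mul_cancel _

/-- A point `(x : 1 : y)` of the conic `a X ^ 2 + b Y ^ 2 = Z ^ 2` provides the zero divisor
`x i + j - y` of the quaternion algebra `(a, b)`. -/
theorem mk_quaternionCSA_eq_one (h2 : (2 : k) ≠ 0) (ha : a ≠ 0) (hb : b ≠ 0) {x y : k}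
    (h : y ^ 2 = a * x ^ 2 + b) : mk (quaternionCSA h2 ha hb) = 1 := by
  refine mk_eq_one_of_finrank_eq_four (quaternionCSA h2 ha hb)
    (QuaternionAlgebra.finrank_eq_four _ _ _)
    (x := (⟨-y, x, 1, 0⟩ : ℍ[k,a,0,b])) (y := (⟨y, x, 1, 0⟩ : ℍ[k,a,0,b])) ?_ ?_ ?_
  · intro h0
    exact one_ne_zero congr(QuaternionAlgebra.imJ $h0)
  · intro h0
    exact one_ne_zero congr(QuaternionAlgebra.imJ $h0)
  · refine QuaternionAlgebra.ext ?_ ?_ ?_ ?_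
    · simp
      linear_combination -h
    · simp
      ring
    all_goals simp

end Quaternion

section Conic

variable {E F Ω : Type u} [Field E] [Field F] [Field Ω] [Algebra E F] [Algebra F Ω] [Algebra E Ω]
  [IsScalarTower E F Ω]

/-- The function field `Ω` of the conic `y ^ 2 = a x ^ 2 + b` is an extension of degree at most two
of the rational function field `F = E(x)`. If it splits a division algebra `D` of dimension
`n ^ 2` over `E`, then `F ⊗ D` acts on `Ω ^ n`, whose dimension over `F` is at most `2 n`; hence
`n ≤ 2`. For `n = 2`, the space `Ω ^ n` is free of rank one over `F ⊗ D`, and multiplication by `y`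
provides a square root of `a x ^ 2 + b` in `F ⊗ D`. -/
theorem eq_one_or_eq_mk_quaternionCSA_of_restrict_eq_one [FiniteDimensional F Ω]
    (hΩ : Module.finrank F Ω ≤ 2) {x : F} (ht : Transcendental E x)
    (hx : ∀ y : F, ∃ p q : E[X], y = aeval x p / aeval x q) {a b : E} (h2 : (2 : E) ≠ 0)
    (ha : a ≠ 0) (hb : b ≠ 0) {y : Ω}
    (hy : y * y = algebraMap F Ω (algebraMap E F a * x ^ 2 + algebraMap E F b))
    {c : BrauerGroup.{u, u} E} (hc : restrict E Ω c = 1) :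
    c = 1 ∨ c = mk (quaternionCSA h2 ha hb) := by
  obtain ⟨D, _, _, h₁, h₃, rfl⟩ := exists_divisionRing c
  rw [restrict_mk] at hc
  obtain ⟨n, hn, ⟨φ⟩⟩ := exists_algHom_end_of_mk_eq_one hc
  replace hn : n ^ 2 = Module.finrank E D := hn.trans Module.finrank_baseChange
  replace φ : Ω ⊗[E] D →ₐ[Ω] Module.End Ω (Fin n → Ω) := φ
  have hdom : IsDomain (F ⊗[E] D) := isDomain_tensorProduct_of_transcendental ht hx
  have hpos : 0 < Module.finrank E D := Module.finrank_pos
  have hn0 : 0 < n := Nat.pos_of_ne_zero (by rintro rfl; simp at hn; omega)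
  let ι : F ⊗[E] D →ₐ[F] Ω ⊗[E] D :=
    Algebra.TensorProduct.map (Algebra.ofId F Ω) (AlgHom.id E D)
  let ψ : F ⊗[E] D →ₐ[F] Module.End F (Fin n → Ω) := AlgHom.ofLinearMap
    { toFun := fun d => (φ (ι d)).restrictScalars F
      map_add' := fun d e => by ext; simp
      map_smul' := fun r d => by
        ext
        rw [map_smul, ← algebraMap_smul Ω r (ι d), map_smul]
        simp }
    (by ext; simp) (fun d e => by ext; simp)
  have hψ (d) (r : Ω) (w : Fin n → Ω) : ψ d (r • w) = r • ψ d w := (φ (ι d)).map_smul r w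
  let v : Fin n → Ω := fun _ => 1
  have hv : v ≠ 0 := fun h => one_ne_zero congr($h ⟨0, hn0⟩)
  have hinj := injective_apply_of_isDomain ψ hv
  let T : F ⊗[E] D →ₗ[F] (Fin n → Ω) := (LinearMap.applyₗ v).comp ψ.toLinearMap
  have hFD : Module.finrank F (F ⊗[E] D) = n ^ 2 := Module.finrank_baseChange.trans hn.symm
  have hV : Module.finrank F (Fin n → Ω) ≤ n * 2 := by
    rw [Module.finrank_pi_fintype, Finset.sum_const, Finset.card_univ, Fintype.card_fin,
      smul_eq_mul]
    exact Nat.mul_le_mul_left _ hΩ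
  have hle := LinearMap.finrank_le_finrank_of_injective (f := T) hinj
  rw [hFD] at hle
  have hn2 : n ≤ 2 := by nlinarith
  obtain rfl | rfl : n = 1 ∨ n = 2 := by omega
  · exact Or.inl (mk_eq_one_of_finrank_eq_one _ hn.symm)
  · refine Or.inr ?_
    have hsurj : Function.Surjective T :=
      (LinearMap.injective_iff_surjective_of_finrank_eq_finrank (by omega)).mp hinj
    obtain ⟨θ, hθ⟩ := hsurj (y • v)
    replace hθ : ψ θ v = y • v := hθ
    have hsq : θ * θ = (algebraMap E F a * x ^ 2 + algebraMap E F b) ⊗ₜ[E] 1 := by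
      apply hinj
      have h1 : (algebraMap E F a * x ^ 2 + algebraMap E F b) ⊗ₜ[E] (1 : D) =
          algebraMap F (F ⊗[E] D) (algebraMap E F a * x ^ 2 + algebraMap E F b) := by
        rw [Algebra.TensorProduct.algebraMap_apply, Algebra.algebraMap_self_apply]
      simp only
      rw [map_mul, Module.End.mul_apply, hθ, hψ, hθ, smul_smul, hy, h1, AlgHom.commutes,
        Module.algebraMap_end_apply, algebraMap_smul]
    obtain ⟨u, w, hu, hw, huw⟩ := exists_anticommuting_of_tensorProduct ht hx ha hsq
    exact mk_eq_mk_quaternionCSA h2 ha hb (mkCSA D h₁ inferInstance h₃) hn.symm hu hw huw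

end Conic

end BrauerGroup

/-! ### Cones over conics -/

theorem AlgebraicIndependent.transcendental_intermediateField_adjoin {k Ω ι : Type*} [Field k]
    [Field Ω] [Algebra k Ω] {z : ι → Ω} (hz : AlgebraicIndependent k z) {s : Set ι} {i : ι}
    (hi : i ∉ s) : Transcendental (IntermediateField.adjoin k (z '' s)) (z i) := by
  have h := hz.transcendental_adjoin hi
  open scoped IntermediateField.algebraAdjoinAdjoin in
  exact fun h' => h ((IsFractionRing.isAlgebraic_iff (Algebra.adjoin k (z '' s))
    (IntermediateField.adjoin k (z '' s)) Ω).mpr h')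

namespace BrauerGroup

open Polynomial IntermediateField

/-- Every element of `E(z)` is a quotient of polynomials in `z`. -/
theorem exists_eq_aeval_gen_div {E Ω : Type*} [Field E] [Field Ω] [Algebra E Ω] (z : Ω) (y : E⟮z⟯) :
    ∃ p q : E[X], y = aeval (AdjoinSimple.gen E z) p / aeval (AdjoinSimple.gen E z) q := by
  obtain ⟨p, q, h⟩ := (mem_adjoin_simple_iff E y.1).mp y.2
  refine ⟨p, q, Subtype.ext ?_⟩
  rw [h, IntermediateField.coe_div, AdjoinSimple.coe_aeval_gen_apply,
    AdjoinSimple.coe_aeval_gen_apply]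

theorem transcendental_gen {E Ω : Type*} [Field E] [Field Ω] [Algebra E Ω] {z : Ω}
    (hz : Transcendental E z) : Transcendental E (AdjoinSimple.gen E z) := by
  rw [← transcendental_algebraMap_iff (A := Ω) (FaithfulSMul.algebraMap_injective _ _),
    AdjoinSimple.algebraMap_gen]
  exact hz

/-- The function field `E(x, y)` of the conic `y ^ 2 = a x ^ 2 + b` splits at most one nontrivial
Brauer class, the class of the quaternion algebra `(a, b)`. -/
theorem eq_one_or_eq_mk_quaternionCSA_of_conic {E Ω : Type u} [Field E] [Field Ω] [Algebra E Ω]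
    {x y : Ω} (hx : Transcendental E x) {a b : E} (h2 : (2 : E) ≠ 0) (ha : a ≠ 0) (hb : b ≠ 0)
    (hy : y ^ 2 = algebraMap E Ω a * x ^ 2 + algebraMap E Ω b)
    (hgen : IntermediateField.adjoin E {x, y} = ⊤) {c : BrauerGroup.{u, u} E}
    (hc : restrict E Ω c = 1) : c = 1 ∨ c = mk (quaternionCSA h2 ha hb) := by
  let f : E⟮x⟯ := algebraMap E E⟮x⟯ a * (AdjoinSimple.gen E x) ^ 2 + algebraMap E E⟮x⟯ b
  have hf : algebraMap E⟮x⟯ Ω f = y ^ 2 := by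
    rw [hy, map_add, map_mul, map_pow, AdjoinSimple.algebraMap_gen]
    rfl
  have htop : E⟮x⟯⟮y⟯ = ⊤ := by
    rw [← restrictScalars_eq_top_iff (K := E), adjoin_simple_adjoin_simple, hgen]
  have hroot : aeval y (X ^ 2 - C f) = 0 := by
    rw [map_sub, map_pow, aeval_X, aeval_C, hf, sub_self]
  have hmonic := monic_X_pow_sub_C f two_ne_zero
  have hint : IsIntegral E⟮x⟯ y := ⟨_, hmonic, hroot⟩
  have hfin : FiniteDimensional E⟮x⟯ Ω := by
    have := adjoin.finiteDimensional hint
    rw [htop] at this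
    exact Module.Finite.equiv topEquiv.toLinearEquiv
  have hdim : Module.finrank E⟮x⟯ Ω ≤ 2 := by
    rw [← finrank_top', ← htop, adjoin.finrank hint]
    refine (natDegree_le_of_dvd (minpoly.dvd _ _ hroot) hmonic.ne_zero).trans ?_
    rw [natDegree_X_pow_sub_C]
  exact eq_one_or_eq_mk_quaternionCSA_of_restrict_eq_one hdim (transcendental_gen hx)
    (exists_eq_aeval_gen_div _) h2 ha hb ((sq y).symm.trans hf.symm) hc

/-- The function field of a cone over the conic `Z ^ 2 = a X ^ 2 + b Y ^ 2` is the function field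
of the same conic over a purely transcendental extension of `k`. -/
theorem eq_one_or_eq_mk_quaternionCSA_of_cone {k Ω : Type u} [Field k] [Field Ω] [Algebra k Ω]
    {X Y Z T : Ω} (hind : AlgebraicIndependent k ![Y, T, X]) {a b : k} (h2 : (2 : k) ≠ 0)
    (ha : a ≠ 0) (hb : b ≠ 0) (hZ : Z ^ 2 = algebraMap k Ω a * X ^ 2 + algebraMap k Ω b * Y ^ 2)
    (hgen : IntermediateField.adjoin k {X, Y, Z, T} = ⊤) {c : BrauerGroup.{u, u} k}
    (hc : restrict k Ω c = 1) : c = 1 ∨ c = mk (quaternionCSA h2 ha hb) := by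
  have hY : Transcendental k Y := hind.transcendental 0
  have hY0 : Y ≠ 0 := fun h => hY (h ▸ isAlgebraic_zero)
  have hT : Transcendental k⟮Y⟯ T := by
    have h := hind.transcendental_intermediateField_adjoin (s := {0}) (i := 1) (by simp)
    rwa [Set.image_singleton] at h
  have hX : Transcendental k⟮Y⟯⟮T⟯ X := by
    have h := hind.transcendental_intermediateField_adjoin (s := {0, 1}) (i := 2) (by simp)
    rw [Set.image_pair] at h
    have e : k⟮Y⟯⟮T⟯.restrictScalars k = k⟮Y, T⟯ := adjoin_simple_adjoin_simple k Y T
    change Transcendental k⟮Y, T⟯ X at h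
    rw [← e] at h
    exact h
  let E := k⟮Y⟯⟮T⟯
  have : IsScalarTower k E Ω := .of_algebraMap_eq fun _ => rfl
  obtain ⟨Y', hY'⟩ : ∃ Y' : E, algebraMap E Ω Y' = Y :=
    ⟨algebraMap k⟮Y⟯ E (AdjoinSimple.gen k Y), rfl⟩
  have hx : Transcendental E (X / Y) := by
    intro h
    have h' := h.mul (isAlgebraic_algebraMap (A := Ω) Y')
    rw [hY', div_mul_cancel₀ _ hY0] at h'
    exact hX h'
  have htop : IntermediateField.adjoin E {X / Y, Z / Y} = ⊤ := by
    have hXF : X / Y ∈ IntermediateField.adjoin E {X / Y, Z / Y} := subset_adjoin _ _ (by simp)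
    have hZF : Z / Y ∈ IntermediateField.adjoin E {X / Y, Z / Y} := subset_adjoin _ _ (by simp)
    have hYF : Y ∈ IntermediateField.adjoin E {X / Y, Z / Y} := by
      have h := (IntermediateField.adjoin E {X / Y, Z / Y}).algebraMap_mem Y'
      rwa [hY'] at h
    have hTF : T ∈ IntermediateField.adjoin E {X / Y, Z / Y} :=
      (IntermediateField.adjoin E {X / Y, Z / Y}).algebraMap_mem (AdjoinSimple.gen k⟮Y⟯ T)
    have hle : IntermediateField.adjoin k {X, Y, Z, T} ≤
        (IntermediateField.adjoin E {X / Y, Z / Y}).restrictScalars k := by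
      rw [adjoin_le_iff]
      rintro w (rfl | rfl | rfl | rfl)
      · have h := mul_mem hXF hYF
        rwa [div_mul_cancel₀ _ hY0] at h
      · exact hYF
      · have h := mul_mem hZF hYF
        rwa [div_mul_cancel₀ _ hY0] at h
      · exact hTF
    rw [hgen] at hle
    exact eq_top_iff.mpr fun w _ => hle (mem_top (x := w))
  have hy : (Z / Y) ^ 2 = algebraMap E Ω (algebraMap k E a) * (X / Y) ^ 2 +
      algebraMap E Ω (algebraMap k E b) := by
    rw [← IsScalarTower.algebraMap_apply, ← IsScalarTower.algebraMap_apply, div_pow, hZ]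
    field_simp
  have hinj : Function.Injective (restrict k E) := by
    have h1 := restrict_injective_of_transcendental (transcendental_gen hY)
      (exists_eq_aeval_gen_div Y)
    have h2 := restrict_injective_of_transcendental (transcendental_gen hT)
      (exists_eq_aeval_gen_div T)
    intro c d h
    rw [← restrict_restrict k k⟮Y⟯ E, ← restrict_restrict k k⟮Y⟯ E] at h
    exact h1 (h2 h)
  have hk (r : k) (hr : r ≠ 0) : algebraMap k E r ≠ 0 :=
    (map_ne_zero_iff _ (algebraMap k E).injective).mpr hr
  have h2E : (2 : E) ≠ 0 := by
    have h := hk 2 h2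
    rwa [map_ofNat] at h
  rw [← restrict_restrict k E Ω] at hc
  rcases eq_one_or_eq_mk_quaternionCSA_of_conic hx h2E (hk a ha) (hk b hb) hy htop hc with h | h
  · exact Or.inl (hinj (by rw [h, map_one]))
  · exact Or.inr (hinj (by rw [h, restrict_mk_quaternionCSA]))

end BrauerGroup

/-! ### Coordinates on a quadric surface cone -/

namespace Quadric

section LinearForms

variable {k : Type*} [Field k] {n : ℕ}

/-- The homogeneous linear polynomial of a linear form on `k ^ n`. -/
noncomputable def linearPolynomial : Module.Dual k (Fin n → k) →ₗ[k] MvPolynomial (Fin n) k where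
  toFun f := ∑ j, MvPolynomial.C (f (Pi.single j 1)) * MvPolynomial.X j
  map_add' f g := by simp [add_mul, Finset.sum_add_distrib]
  map_smul' r f := by simp [Finset.smul_sum, MvPolynomial.smul_eq_C_mul, mul_assoc]

theorem linearPolynomial_apply (f : Module.Dual k (Fin n → k)) :
    linearPolynomial f = ∑ j, MvPolynomial.C (f (Pi.single j 1)) * MvPolynomial.X j := rfl

theorem linearPolynomial_isHomogeneous (f : Module.Dual k (Fin n → k)) :
    (linearPolynomial f).IsHomogeneous 1 :=
  MvPolynomial.IsHomogeneous.sum _ _ _ fun j _ => (MvPolynomial.isHomogeneous_X _ j).C_mul _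

theorem linearPolynomial_proj (j : Fin n) :
    linearPolynomial (LinearMap.proj (R := k) j) = MvPolynomial.X j := by
  rw [linearPolynomial_apply, Finset.sum_eq_single j (by simp +contextual) (by simp)]
  simp

/-- The `i`-th coordinate in the linear coordinate system `e`, as a polynomial. -/
noncomputable def coordinate (e : (Fin n → k) ≃ₗ[k] (Fin n → k)) (i : Fin n) :
    MvPolynomial (Fin n) k :=
  linearPolynomial (LinearMap.proj i ∘ₗ e.toLinearMap)

theorem X_eq_sum_coordinate (e : (Fin n → k) ≃ₗ[k] (Fin n → k)) (j : Fin n) :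
    MvPolynomial.X j = ∑ i, e.symm (Pi.single i 1) j • coordinate e i := by
  simp_rw [coordinate, ← map_smul, ← map_sum, ← linearPolynomial_proj]
  congr 1
  refine LinearMap.ext fun v => ?_
  have h : v = ∑ i, e v i • e.symm (Pi.single i 1) := by
    apply e.injective
    rw [map_sum]
    simp only [map_smul, LinearEquiv.apply_symm_apply]
    exact pi_eq_sum_univ' (e v)
  conv_lhs => rw [LinearMap.proj_apply, h]
  simp [mul_comm]

/-- Points over an extension field can be prescribed by their coordinates. -/
theorem exists_aeval_coordinate_eq {K : Type*} [Field K] [Algebra k K]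
    (e : (Fin n → k) ≃ₗ[k] (Fin n → k)) (α : Fin n → K) :
    ∃ v : Fin n → K, ∀ i, MvPolynomial.aeval v (coordinate e i) = α i := by
  refine ⟨fun j => ∑ l, algebraMap k K (e.symm (Pi.single l 1) j) * α l, fun i => ?_⟩
  have h (l : Fin n) : ∑ j, e (Pi.single j 1) i * e.symm (Pi.single l 1) j =
      (Pi.single l 1 : Fin n → k) i := by
    conv_rhs => rw [← e.apply_symm_apply (Pi.single l 1), pi_eq_sum_univ' (e.symm (Pi.single l 1)),
      map_sum]
    simp [mul_comm]
  calc _ = ∑ j, algebraMap k K (e (Pi.single j 1) i) *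
        ∑ l, algebraMap k K (e.symm (Pi.single l 1) j) * α l := by
        simp [coordinate, linearPolynomial_apply]
    _ = ∑ l, algebraMap k K (∑ j, e (Pi.single j 1) i * e.symm (Pi.single l 1) j) * α l := by
        simp_rw [Finset.mul_sum, map_sum, Finset.sum_mul, map_mul, mul_assoc]
        exact Finset.sum_comm
    _ = α i := by
        simp_rw [h]
        rw [Finset.sum_eq_single i (fun l _ hl => by simp [hl.symm]) (by simp)]
        simp

theorem toPolynomial_eq_of_forall [Invertible (2 : k)] {ι : Type*} [Fintype ι]
    (q : QuadraticForm k (Fin n → k)) (w : ι → k) (f : ι → Module.Dual k (Fin n → k))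
    (h : ∀ v, q v = ∑ l, w l * (f l v) ^ 2) :
    toPolynomial q = ∑ l, MvPolynomial.C (w l) * linearPolynomial (f l) ^ 2 := by
  have hassoc (x y) : QuadraticMap.associated (R := k) q x y = ∑ l, w l * (f l x * f l y) := by
    have h2 : (2 : k) ≠ 0 := Invertible.ne_zero 2
    apply mul_left_cancel₀ h2
    have := congr($(QuadraticMap.two_nsmul_associated k q) x y)
    simp only [LinearMap.smul_apply, nsmul_eq_mul, QuadraticMap.polarBilin_apply_apply,
      QuadraticMap.polar, h, map_add, Nat.cast_ofNat] at this
    rw [this, Finset.mul_sum, ← Finset.sum_sub_distrib, ← Finset.sum_sub_distrib]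
    exact Finset.sum_congr rfl fun l _ => by ring
  calc toPolynomial q = ∑ i, ∑ j, ∑ l, MvPolynomial.C (w l) *
        ((MvPolynomial.C (f l (Pi.single i 1)) * MvPolynomial.X i) *
          (MvPolynomial.C (f l (Pi.single j 1)) * MvPolynomial.X j)) := by
        refine Finset.sum_congr rfl fun i _ => Finset.sum_congr rfl fun j _ => ?_
        rw [hassoc, map_sum, Finset.sum_mul, Finset.sum_mul]
        refine Finset.sum_congr rfl fun l _ => ?_
        rw [map_mul, map_mul]
        ring
    _ = ∑ l, ∑ i, ∑ j, MvPolynomial.C (w l) *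
        ((MvPolynomial.C (f l (Pi.single i 1)) * MvPolynomial.X i) *
          (MvPolynomial.C (f l (Pi.single j 1)) * MvPolynomial.X j)) :=
        (Finset.sum_congr rfl fun i _ => Finset.sum_comm).trans Finset.sum_comm
    _ = _ := by simp_rw [linearPolynomial_apply, sq, Finset.sum_mul_sum, Finset.mul_sum]

end LinearForms

/-- The even Clifford algebra of `w₀ X ^ 2 + w₁ Y ^ 2 + w₂ Z ^ 2` is the quaternion algebra
`(-w₀ / w₂, -w₁ / w₂)`. -/
theorem nonempty_even_equiv_quaternion {k V : Type*} [Field k] [Invertible (2 : k)]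
    [AddCommGroup V] [Module k V] (q : QuadraticForm k V) (w : Fin 3 → kˣ)
    (e : q.IsometryEquiv (QuadraticMap.weightedSumSquares k w)) :
    Nonempty (CliffordAlgebra.even q ≃ₐ[k]
      ℍ[k,((-(w 0 / w 2) : kˣ) : k),0,((-(w 1 / w 2) : kˣ) : k)]) := by
  let g : (Fin 3 → k) ≃ₗ[k] (k × k) × k :=
    { toFun := fun v => ((v 0, v 1), v 2)
      invFun := fun p => ![p.1.1, p.1.2, p.2]
      map_add' := fun _ _ => rfl
      map_smul' := fun _ _ => rfl
      left_inv := fun v => by ext i; fin_cases i <;> rfl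
      right_inv := fun _ => rfl }
  have hg (v : Fin 3 → k) : g v = ((v 0, v 1), v 2) := rfl
  refine ⟨(evenEquivOfSimilarity q (CliffordAlgebra.EquivEven.Q' (CliffordAlgebraQuaternion.Q
      ((-(w 0 / w 2) : kˣ) : k) ((-(w 1 / w 2) : kˣ) : k)))
    (e.toLinearEquiv.trans g) (-(w 2)⁻¹) fun v => ?_).trans
      ((CliffordAlgebra.equivEven _).symm.trans CliffordAlgebraQuaternion.equiv)⟩
  rw [← e.map_app v, QuadraticMap.weightedSumSquares_apply, Fin.sum_univ_three]
  simp [hg, Units.smul_def]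
  field_simp
  ring

end Quadric

namespace QuadricSurfaceCone

open BrauerGroup

variable {k : Type u} [Field k] [Invertible (2 : k)] (Q : QuadricSurfaceCone k)

/-- The cone has the equation `w 0 * X ^ 2 + w 1 * Y ^ 2 + w 2 * Z ^ 2 = 0` in suitable coordinates,
and the Clifford invariant of its base is the class of the corresponding quaternion algebra. -/
theorem exists_coordinates (h2 : (2 : k) ≠ 0) :
    ∃ (e : (Fin 4 → k) ≃ₗ[k] (Fin 4 → k)) (w : Fin 3 → kˣ),
      (∀ v, Q.form v = w 0 * e v 0 ^ 2 + w 1 * e v 1 ^ 2 + w 2 * e v 2 ^ 2) ∧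
      Q.baseCliffordInvariant = BrauerGroup.mk (quaternionCSA (a := ((-(w 0 / w 2) : kˣ) : k))
        (b := ((-(w 1 / w 2) : kˣ) : k)) h2 (Units.ne_zero _) (Units.ne_zero _)) := by
  obtain ⟨w, ⟨f⟩⟩ : ∃ w : Fin 3 → kˣ, Q.base.Equivalent (QuadraticMap.weightedSumSquares k w) := by
    rw [← Q.finrank_plane]
    exact Q.base.equivalent_weightedSumSquares_units_of_nondegenerate'
      Q.isSmooth_base.separatingLeft
  let φ := Submodule.prodEquivOfIsCompl _ _ Q.isCompl
  let ψ : Q.vertex.submodule ≃ₗ[k] k := LinearEquiv.ofFinrankEq _ _ (by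
    rw [Projectivization.finrank_submodule, Module.finrank_self])
  let σ : (k × (Fin 3 → k)) ≃ₗ[k] (Fin 4 → k) :=
    { toFun := fun p => ![p.2 0, p.2 1, p.2 2, p.1]
      invFun := fun v => (v 3, ![v 0, v 1, v 2])
      map_add' := fun _ _ => by ext i; fin_cases i <;> rfl
      map_smul' := fun _ _ => by ext i; fin_cases i <;> rfl
      left_inv := fun p => Prod.ext rfl (by ext i; fin_cases i <;> rfl)
      right_inv := fun v => by ext i; fin_cases i <;> rfl }
  refine ⟨φ.symm.trans ((ψ.prodCongr f.toLinearEquiv).trans σ), w, fun v => ?_, ?_⟩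
  · obtain ⟨⟨x, y⟩, rfl⟩ := φ.surjective v
    have hφ : φ (x, y) = (x : Fin 4 → k) + y := Submodule.coe_prodEquivOfIsCompl' _ _ _ _
    have hf : Q.form y = w 0 * f y 0 ^ 2 + w 1 * f y 1 ^ 2 + w 2 * f y 2 ^ 2 := by
      refine (f.map_app y).symm.trans ?_
      rw [QuadraticMap.weightedSumSquares_apply, Fin.sum_univ_three]
      simp [Units.smul_def, sq]
    rw [hφ, Q.form_add _ x.2 _ y.2, hf, ← hφ]
    simp only [LinearEquiv.trans_apply, LinearEquiv.symm_apply_apply]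
    rfl
  · obtain ⟨ε⟩ := nonempty_even_equiv_quaternion Q.base w f
    exact mk_eq_of_algEquiv (B := quaternionCSA h2 (Units.ne_zero _) (Units.ne_zero _)) ε

theorem toFrac_toPolynomial : Q.toFrac (toPolynomial Q.form) = 0 := by
  have h : Ideal.Quotient.mk (Ideal.span {toPolynomial Q.form}) (toPolynomial Q.form) = 0 :=
    Ideal.Quotient.eq_zero_iff_mem.mpr (Ideal.mem_span_singleton_self _)
  change algebraMap Q.coordinateRing (FractionRing Q.coordinateRing)
    (Ideal.Quotient.mk (Ideal.span {toPolynomial Q.form}) _) = _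
  rw [h, map_zero]

theorem dvd_of_toFrac_eq_zero {P : MvPolynomial (Fin 4) k} (h : Q.toFrac P = 0) :
    toPolynomial Q.form ∣ P := by
  change algebraMap Q.coordinateRing (FractionRing Q.coordinateRing)
    (Ideal.Quotient.mk (Ideal.span {toPolynomial Q.form}) P) = 0 at h
  rw [FaithfulSMul.algebraMap_eq_zero_iff, Ideal.Quotient.eq_zero_iff_mem,
    Ideal.mem_span_singleton] at h
  exact h

theorem adjoin_toFrac_coordinate (e : (Fin 4 → k) ≃ₗ[k] (Fin 4 → k)) :
    IntermediateField.adjoin k {Q.toFrac (coordinate e 0), Q.toFrac (coordinate e 1),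
      Q.toFrac (coordinate e 2), Q.toFrac (coordinate e 3)} = ⊤ := by
  set S : IntermediateField k (FractionRing Q.coordinateRing) := IntermediateField.adjoin k
    {Q.toFrac (coordinate e 0), Q.toFrac (coordinate e 1),
      Q.toFrac (coordinate e 2), Q.toFrac (coordinate e 3)}
  have h1 (i : Fin 4) : Q.toFrac (coordinate e i) ∈ S := by
    apply IntermediateField.subset_adjoin
    fin_cases i <;> simp
  have h2 (P : MvPolynomial (Fin 4) k) : Q.toFrac P ∈ S := by
    induction P using MvPolynomial.induction_on with
    | C a =>
      rw [← MvPolynomial.algebraMap_eq, AlgHom.commutes]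
      exact S.algebraMap_mem a
    | add P R hP hR => rw [map_add]; exact add_mem hP hR
    | mul_X P j hP =>
      rw [map_mul, X_eq_sum_coordinate e j, map_sum]
      refine mul_mem hP (sum_mem fun i _ => ?_)
      rw [map_smul]
      exact S.smul_mem (h1 i)
  refine eq_top_iff.mpr fun z _ => ?_
  obtain ⟨r, s, -, rfl⟩ := IsFractionRing.div_surjective (A := Q.coordinateRing) z
  obtain ⟨R, rfl⟩ := Ideal.Quotient.mk_surjective r
  obtain ⟨P, rfl⟩ := Ideal.Quotient.mk_surjective s
  exact div_mem (h2 R) (h2 P)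

/-- On the cone `w 0 * X ^ 2 + w 1 * Y ^ 2 + w 2 * Z ^ 2 = 0`, the coordinates `Y`, `T` and `X` are
algebraically independent: over the algebraic closure, they take arbitrary values. -/
theorem algebraicIndependent_coordinate {e : (Fin 4 → k) ≃ₗ[k] (Fin 4 → k)} {w : Fin 3 → kˣ}
    (h : toPolynomial Q.form = MvPolynomial.C (w 0 : k) * coordinate e 0 ^ 2 +
      MvPolynomial.C (w 1 : k) * coordinate e 1 ^ 2 +
      MvPolynomial.C (w 2 : k) * coordinate e 2 ^ 2) :
    AlgebraicIndependent k ![Q.toFrac (coordinate e 1), Q.toFrac (coordinate e 3),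
      Q.toFrac (coordinate e 0)] := by
  rw [algebraicIndependent_iff]
  intro p hp
  let ℓ : Fin 3 → MvPolynomial (Fin 4) k := ![coordinate e 1, coordinate e 3, coordinate e 0]
  have hℓ : ![Q.toFrac (coordinate e 1), Q.toFrac (coordinate e 3), Q.toFrac (coordinate e 0)] =
      fun i => Q.toFrac (ℓ i) := by
    ext i
    fin_cases i <;> rfl
  rw [hℓ, ← MvPolynomial.comp_aeval_apply] at hp
  obtain ⟨R, hR⟩ := Q.dvd_of_toFrac_eq_zero hp
  let K := AlgebraicClosure k
  apply MvPolynomial.map_injective _ (algebraMap k K).injective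
  rw [map_zero]
  refine MvPolynomial.funext fun β => ?_
  rw [map_zero, MvPolynomial.eval_map, ← MvPolynomial.aeval_def]
  obtain ⟨γ, hγ⟩ := IsAlgClosed.exists_pow_nat_eq
    (-(algebraMap k K (w 0) * β 2 ^ 2 + algebraMap k K (w 1) * β 0 ^ 2) / algebraMap k K (w 2))
    two_pos
  obtain ⟨v, hv⟩ := exists_aeval_coordinate_eq e ![β 2, β 0, γ, β 1]
  have hβ : β = fun i => MvPolynomial.aeval v (ℓ i) := by
    ext i
    fin_cases i
    · exact (hv 1).symm
    · exact (hv 3).symm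
    · exact (hv 0).symm
  have hw : algebraMap k K (w 2) ≠ 0 :=
    (map_ne_zero_iff _ (algebraMap k K).injective).mpr (w 2).ne_zero
  have hzero : MvPolynomial.aeval v (toPolynomial Q.form) = 0 := by
    rw [h]
    simp only [map_add, map_mul, map_pow, MvPolynomial.aeval_C, hv]
    simp only [Matrix.cons_val]
    rw [hγ, mul_div_cancel₀ _ hw]
    ring
  rw [hβ, ← MvPolynomial.comp_aeval_apply, hR, map_mul, hzero, zero_mul]

theorem div_mem_functionField {A B : MvPolynomial (Fin 4) k} {d : ℕ} (hA : A.IsHomogeneous d)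
    (hB : B.IsHomogeneous d) (hB0 : Q.toFrac B ≠ 0) :
    Q.toFrac A / Q.toFrac B ∈ Q.functionField :=
  ⟨d, A, B, hA, hB, hB0, rfl⟩

end QuadricSurfaceCone

/-! ### The kernel of the restriction to the function field -/

theorem mainTheorem11 {k : Type*} [Field k] [Invertible (2 : k)] (Q : QuadricSurfaceCone k) :
    (BrauerGroup.restrict k Q.functionField).ker = Subgroup.zpowers Q.baseCliffordInvariant ∧
      Q.baseCliffordInvariant ^ 2 = 1 := by
  have h2 : (2 : k) ≠ 0 := Invertible.ne_zero 2
  obtain ⟨e, w, hform, hclass⟩ := Q.exists_coordinates h2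
  have hpoly : toPolynomial Q.form = MvPolynomial.C (w 0 : k) * coordinate e 0 ^ 2 +
      MvPolynomial.C (w 1 : k) * coordinate e 1 ^ 2 +
      MvPolynomial.C (w 2 : k) * coordinate e 2 ^ 2 := by
    rw [toPolynomial_eq_of_forall Q.form (fun l => (w l : k))
      (fun l : Fin 3 => LinearMap.proj l.castSucc ∘ₗ e.toLinearMap)
      (fun v => by rw [hform, Fin.sum_univ_three]; rfl), Fin.sum_univ_three]
    rfl
  have hind := Q.algebraicIndependent_coordinate hpoly
  have hY0 : Q.toFrac (coordinate e 1) ≠ 0 := hind.ne_zero 0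
  have hw : algebraMap k (FractionRing Q.coordinateRing) (w 2) ≠ 0 :=
    (map_ne_zero_iff _ (algebraMap k _).injective).mpr (w 2).ne_zero
  have hrel : Q.toFrac (coordinate e 2) ^ 2 =
      algebraMap k _ ((-(w 0 / w 2) : kˣ) : k) * Q.toFrac (coordinate e 0) ^ 2 +
      algebraMap k _ ((-(w 1 / w 2) : kˣ) : k) * Q.toFrac (coordinate e 1) ^ 2 := by
    have h := congr(Q.toFrac $hpoly).symm.trans Q.toFrac_toPolynomial
    simp only [map_add, map_mul, map_pow, ← MvPolynomial.algebraMap_eq, AlgHom.commutes] at h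
    apply mul_left_cancel₀ hw
    simp only [Units.val_neg, Units.val_div_eq_div_val, map_neg, map_div₀]
    field_simp
    linear_combination h
  rw [hclass]
  -- a class split by the function field of the cone is split by the larger field of fractions of
  -- the homogeneous coordinate ring
  refine ⟨le_antisymm (fun c hc => ?_) ?_, BrauerGroup.mk_quaternionCSA_sq h2 _ _⟩
  · have hc' : BrauerGroup.restrict k (FractionRing Q.coordinateRing) c = 1 := by
      rw [← BrauerGroup.restrict_restrict k Q.functionField, MonoidHom.mem_ker.mp hc, map_one]
    rcases BrauerGroup.eq_one_or_eq_mk_quaternionCSA_of_cone hind h2 (Units.ne_zero _)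
      (Units.ne_zero _) hrel (Q.adjoin_toFrac_coordinate e) hc' with h | h
    · exact h ▸ one_mem _
    · exact h ▸ Subgroup.mem_zpowers _
  -- the point `(X / Y : 1 : Z / Y)` of the conic is rational over the function field
  · rw [Subgroup.zpowers_le, MonoidHom.mem_ker]
    have hk (r : kˣ) : algebraMap k Q.functionField r ≠ 0 :=
      (map_ne_zero_iff _ (algebraMap k Q.functionField).injective).mpr r.ne_zero
    have h2K : (2 : Q.functionField) ≠ 0 := by
      have h := (map_ne_zero_iff _ (algebraMap k Q.functionField).injective).mpr h2
      rwa [map_ofNat] at h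
    rw [BrauerGroup.restrict_mk_quaternionCSA _ _ _ _ h2K (hk _) (hk _)]
    have hom (i) : (coordinate e i).IsHomogeneous 1 := linearPolynomial_isHomogeneous _
    refine BrauerGroup.mk_quaternionCSA_eq_one _ _ _
      (x := ⟨_, Q.div_mem_functionField (hom 0) (hom 1) hY0⟩)
      (y := ⟨_, Q.div_mem_functionField (hom 2) (hom 1) hY0⟩) (Subtype.ext ?_)
    change (Q.toFrac (coordinate e 2) / Q.toFrac (coordinate e 1)) ^ 2 =
      algebraMap k _ ((-(w 0 / w 2) : kˣ) : k) *
        (Q.toFrac (coordinate e 0) / Q.toFrac (coordinate e 1)) ^ 2 +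
      algebraMap k _ ((-(w 1 / w 2) : kˣ) : k)
    rw [div_pow, hrel]
    field_simp
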